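/- Let $2<p\le 4$, $\alpha>0$ and $\mu>0$. For $u\in H^1(0,\infty)$ (real- or complex-valued; the result holds in both settings), identified with its continuous representative on $[0,\infty)$, let $$F(u)=\frac12\int_0^\infty |u'|^2\,dx-\frac1p\int_0^\infty |u|^p\,dx+\frac{\alpha}{2}|u(0)|^2 .$$ A *ground state at mass $\mu$* is a global minimizer of $F$ among all $u\in H^1(0,\infty)$ with $\int_0^\infty|u|^2\,dx=\mu$. A *bound state of mass $\mu$* is a real-valued $u\in H^1(0,\infty)$ with $\int_0^\infty|u|^2\,dx=\mu$ such that, for some $\omega>0$, $$-u''-|u|^{p-2}u+\omega u=0\ \text{ on }(0,\infty),\qquad u'(0)=\alpha u(0).$$ For $\omega>0$ the *soliton of frequency $\omega$* is $$\phi_\omega(x)=\Big[\tfrac p2\,\omega\,\operatorname{sech}^2\!\big((\tfrac p2-1)\sqrt\omega\,|x|\big)\Big]^{\frac1{p-2}},\qquad x\in\mathbb R .$$ Call a real-valued $u$ *positive* if $u(x)>0$ for all $x>0$. Then ground states at mass $\mu$ exist if and only if $\mu>\|\phi_{\alpha^2}\|_{L^2(\mathbb R)}^2$. Moreover, whenever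 ground states at mass $\mu$ exist, there is exactly one positive ground state at mass $\mu$ and exactly one positive bound state of mass $\mu$, and the two coincide; this function is the restriction to $[0,\infty)$ of a translated soliton $\phi_\omega(\cdot-a)$ for some $\omega>0$ and $a\in\mathbb R$. -/

import Mathlib

open MeasureTheory Set

namespace NLSHalfLine

noncomputable section

variable {𝕜 : Type*} [RCLike 𝕜]

/-- Lebesgue measure on the open half-line `(0, ∞)`. -/
abbrev halfLine : Measure ℝ := volume.restrict (Ioi 0)

/-- `g` is the weak (distributional) derivative of `u` on `(0, ∞)`: both are locally integrable on
`(0, ∞)` and `∫ φ' u = - ∫ φ g` for all test functions `φ ∈ C_c^∞((0, ∞))`. -/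
def IsWeakDeriv (u g : ℝ → 𝕜) : Prop :=
  LocallyIntegrableOn u (Ioi 0) ∧ LocallyIntegrableOn g (Ioi 0) ∧
    ∀ φ : ℝ → ℝ, ContDiff ℝ (⊤ : ℕ∞) φ → HasCompactSupport φ → tsupport φ ⊆ Ioi 0 →
      ∫ x in Ioi 0, deriv φ x • u x = - ∫ x in Ioi 0, φ x • g x

/-- `u` belongs to the Sobolev space `H¹(0, ∞)`: `u` and its weak derivative are square integrable.
An element of `H¹(0, ∞)` is represented by its continuous representative on `[0, ∞)`, so that `u 0`
is its boundary value; the values of `u` on the negative half-line are irrelevant. -/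
def MemH1 (u : ℝ → 𝕜) : Prop :=
  ContinuousOn u (Ici 0) ∧ MemLp u 2 halfLine ∧ ∃ g, IsWeakDeriv u g ∧ MemLp g 2 halfLine

open Classical in
/-- A weak derivative of `u` on `(0, ∞)` (zero if there is none); it is determined by `u` up to
equality almost everywhere on `(0, ∞)`. -/
def weakDeriv (u : ℝ → 𝕜) : ℝ → 𝕜 :=
  if h : ∃ g, IsWeakDeriv u g then h.choose else 0

/-- The mass `∫₀^∞ |u|²`. -/
def mass (u : ℝ → 𝕜) : ℝ := ∫ x in Ioi 0, ‖u x‖ ^ 2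

/-- The energy `F(u) = ½ ∫₀^∞ |u'|² - (1/p) ∫₀^∞ |u|^p + (α/2) |u(0)|²`. -/
def energy (p α : ℝ) (u : ℝ → 𝕜) : ℝ :=
  1 / 2 * (∫ x in Ioi 0, ‖weakDeriv u x‖ ^ 2) - 1 / p * (∫ x in Ioi 0, ‖u x‖ ^ p)
    + α / 2 * ‖u 0‖ ^ 2

/-- `u` is a ground state at mass `μ`: a global minimizer of the energy among all functions of
`H¹(0, ∞)` of mass `μ`. -/
def IsGroundState (p α μ : ℝ) (u : ℝ → 𝕜) : Prop :=
  MemH1 u ∧ mass u = μ ∧ ∀ v : ℝ → 𝕜, MemH1 v → mass v = μ → energy p α u ≤ energy p α v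

/-- `u` is positive on the half-line `(0, ∞)`. -/
def IsPositive (u : ℝ → ℝ) : Prop := ∀ x, 0 < x → 0 < u x

/-- `u` is a bound state of frequency `ω`: a real-valued solution in `H¹(0, ∞)` of
`-u'' - |u|^(p-2) u + ω u = 0` on `(0, ∞)` with `u'(0) = α u(0)`. The equation is understood in the
sense of distributions, `u'` below being the continuous representative on `[0, ∞)` of the weak
derivative of `u`. -/
def IsBoundStateAt (p α ω : ℝ) (u : ℝ → ℝ) : Prop :=
  MemH1 u ∧ ∃ u' u'' : ℝ → ℝ, IsWeakDeriv u u' ∧ ContinuousOn u' (Ici 0) ∧ IsWeakDeriv u' u'' ∧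
    (∀ x, 0 < x → -u'' x - |u x| ^ (p - 2) * u x + ω * u x = 0) ∧ u' 0 = α * u 0

/-- `u` is a bound state of mass `μ`, of some frequency `ω > 0`. -/
def IsBoundState (p α μ : ℝ) (u : ℝ → ℝ) : Prop :=
  mass u = μ ∧ ∃ ω, 0 < ω ∧ IsBoundStateAt p α ω u

/-- The soliton of frequency `ω` on the real line,
`φ_ω(x) = [(p/2) ω sech²((p/2 - 1) √ω |x|)]^(1/(p-2))`. -/
def soliton (p ω x : ℝ) : ℝ :=
  (p / 2 * ω * (1 / Real.cosh ((p / 2 - 1) * √ω * |x|)) ^ 2) ^ (1 / (p - 2))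

end

end NLSHalfLine

/-!
The proof compares every competitor with the soliton that has the same maximum, by a calibration
(completion of the square); no compactness argument is used.

Put `N = 2 / (p - 2)` and `K = (p / 2) ^ N`. Let `u` have mass `μ` and let `ω` be the frequency of
the soliton whose maximum is that of `|u|`, so that `ω - (2 / p) |u| ^ (p - 2)` is nonnegative;
write `X(v) = √(ω - (2 / p) v ^ (p - 2))`, which is the modulus of the logarithmic derivative of
that soliton at height `v`. From `|u'|² + |u|² X(|u|)² ≥ 2 |u| X(|u|) |u'|`, and because `|u|` has
to rise from `|u 0|` to its maximum and to decay to zero, the energy is bounded below by a function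
of `|u 0|` and `ω`. With the slope `y = X(v)` as variable of integration, minimizing it over the
boundary value gives

  `F(u) ≥ S(ω) - ω μ / 2`,   `S(ω) = (K / 2) ∫_{-α}^{√ω} (ω - y²)₊ ^ N dy`

(`IsProfile.action_le_profileEnergy`). Equality forces `|u'| = |u| X(|u|)` almost everywhere and
`X(|u 0|) = min(α, √ω)`. The condition `p ≤ 4` means `N ≥ 1`, so that `t ↦ t₊ ^ N` is convex and `S`
lies strictly above its tangents (`action_tangent_lt`). The slope of a tangent is half the mass of
the extremal at the frequency of tangency, so `S(ω) - ω μ / 2` is smallest exactly at the frequency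
`ω₀` where this mass is `μ`, and there is at most one such frequency.

Above the critical mass, `ω₀ > α²` and the soliton of frequency `ω₀`, truncated where its
logarithmic derivative is `α`, attains the lower bound (`IsAdmissible.isGroundState`). A positive
ground state attains it too, hence follows the soliton flow and lies above the soliton centred at
its maximum (`IsProfile.soliton_le`), and then equality of the masses identifies it (`IsProfile.eq_soliton`).
A positive bound state is a truncated soliton as well (`IsBoundStateAt.eq_soliton`): its energy
density `v'² - ω v² + (2 / p) v ^ p` vanishes, so `-v' / v` solves a Riccati equation. Its frequency
is `ω₀`, as the mass determines the frequency.

At or below the critical mass, `ω₀ ≤ α²`. Solitons of mass `μ` centred ever further from the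
boundary have energies tending to the lower bound, but equality would force `u 0 = 0`, whereas a
function following the soliton flow lies above a soliton (`not_isGroundState`).
-/

namespace NLSHalfLine

open Filter Topology

/-! ### Weak derivatives on the half-line -/

section WeakDerivative

variable {𝕜 : Type*} [RCLike 𝕜]

lemma integrable_test_smul {f : ℝ → 𝕜} (hf : LocallyIntegrableOn f (Ioi 0)) {φ : ℝ → ℝ}
    (hφ : Continuous φ) (hc : HasCompactSupport φ) (hs : tsupport φ ⊆ Ioi 0) :
    Integrable fun x => φ x • f x := by
  have h1 : IntegrableOn (fun x => φ x • f x) (tsupport φ) :=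
    (hf.integrableOn_compact_subset hs hc).continuousOn_smul hφ.continuousOn hc
  exact h1.integrable_of_forall_notMem_eq_zero fun x hx => by
    rw [image_eq_zero_of_notMem_tsupport hx, zero_smul]

lemma setIntegral_test_smul {φ : ℝ → ℝ} (hs : tsupport φ ⊆ Ioi 0) (f : ℝ → 𝕜) :
    ∫ x in Ioi (0 : ℝ), φ x • f x = ∫ x, φ x • f x :=
  setIntegral_eq_integral_of_forall_compl_eq_zero fun x hx => by
    rw [image_eq_zero_of_notMem_tsupport (fun hx' => hx (hs hx')), zero_smul]

/-- Weak derivatives are unique up to null sets. -/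
lemma IsWeakDeriv.ae_eq {u g h : ℝ → 𝕜} (hg : IsWeakDeriv u g) (hh : IsWeakDeriv u h) :
    g =ᵐ[halfLine] h := by
  have key : ∀ᵐ x, x ∈ Ioi (0 : ℝ) → (g - h) x = 0 := by
    refine isOpen_Ioi.ae_eq_zero_of_integral_contDiff_smul_eq_zero (hg.2.1.sub hh.2.1) ?_
    intro φ hφ hc hs
    have e1 := hg.2.2 φ hφ hc hs
    have e2 := hh.2.2 φ hφ hc hs
    rw [e1, setIntegral_test_smul hs, setIntegral_test_smul hs, neg_inj] at e2
    simp only [Pi.sub_apply, smul_sub]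
    rw [integral_sub (integrable_test_smul hg.2.1 hφ.continuous hc hs)
      (integrable_test_smul hh.2.1 hφ.continuous hc hs), e2, sub_self]
  rw [Filter.EventuallyEq, ae_restrict_iff' measurableSet_Ioi]
  filter_upwards [key] with x hx hx0
  simpa [sub_eq_zero] using hx hx0

lemma IsWeakDeriv.weakDeriv_ae_eq {u g : ℝ → 𝕜} (hg : IsWeakDeriv u g) :
    weakDeriv u =ᵐ[halfLine] g := by
  have h : ∃ g, IsWeakDeriv u g := ⟨g, hg⟩
  have : IsWeakDeriv u (weakDeriv u) := by
    rw [weakDeriv, dif_pos h]; exact h.choose_spec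
  exact this.ae_eq hg

/-- A mean against a normalized bump function is close to the value at the centre. -/
lemma norm_integral_normed_bump_smul_sub_le {u : ℝ → 𝕜} {x ε : ℝ} (f : ContDiffBump x)
    (hu : ∀ t ∈ Metric.ball x f.rOut, ‖u t - u x‖ ≤ ε)
    (hint : Integrable fun t => f.normed volume t • u t) :
    ‖(∫ t, f.normed volume t • u t) - u x‖ ≤ ε := by
  have e : (∫ t, f.normed volume t • u t) - u x = ∫ t, f.normed volume t • (u t - u x) := by
    simp only [smul_sub]
    rw [integral_sub hint (f.integrable_normed.smul_const _), integral_smul_const,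
      f.integral_normed, one_smul]
  have e2 : ε = ∫ t, f.normed volume t * ε := by
    rw [integral_mul_const, f.integral_normed, one_mul]
  rw [e]
  conv_rhs => rw [e2]
  refine norm_integral_le_of_norm_le (f.integrable_normed.mul_const _) (ae_of_all _ fun t => ?_)
  rw [norm_smul, Real.norm_of_nonneg (f.nonneg_normed t)]
  by_cases ht : t ∈ Metric.ball x f.rOut
  · exact mul_le_mul_of_nonneg_left (hu t ht) (f.nonneg_normed t)
  · rw [← f.support_normed_eq (μ := volume), Function.notMem_support] at ht
    simp [ht]

/-- The primitive of a normalized bump function. -/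
lemma integral_normed_bump_eq {x : ℝ} (f : ContDiffBump x) (hf : f.rOut ≤ x) :
    (∀ t ≤ x - f.rOut, ∫ s in (0 : ℝ)..t, f.normed volume s = 0) ∧
    (∀ t, x + f.rOut ≤ t → ∫ s in (0 : ℝ)..t, f.normed volume s = 1) ∧
    (∀ t, 0 ≤ t → ∫ s in (0 : ℝ)..t, f.normed volume s ∈ Icc (0 : ℝ) 1) := by
  have hr := f.rOut_pos
  have hz : ∀ s, s ≤ x - f.rOut ∨ x + f.rOut ≤ s → f.normed volume s = 0 := by
    intro s hs
    rw [← Function.notMem_support, f.support_normed_eq, Metric.mem_ball, Real.dist_eq, not_lt]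
    rcases hs with hs | hs
    · exact le_abs.2 (Or.inr (by linarith))
    · exact le_abs.2 (Or.inl (by linarith))
  refine ⟨fun t ht => ?_, fun t ht => ?_, fun t ht => ⟨?_, ?_⟩⟩
  · rw [intervalIntegral.integral_congr (g := fun _ => (0 : ℝ)), intervalIntegral.integral_zero]
    intro s hs
    refine hz s (Or.inl ?_)
    rcases le_total 0 t with h | h
    · rw [uIcc_of_le h] at hs; exact hs.2.trans ht
    · rw [uIcc_of_ge h] at hs; linarith [hs.2]
  · rw [intervalIntegral.integral_of_le (by linarith), ← f.integral_normed (μ := volume)]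
    refine setIntegral_eq_integral_of_forall_compl_eq_zero fun s hs => hz s ?_
    rw [mem_Ioc, not_and_or, not_lt, not_le] at hs
    rcases hs with hs | hs
    · left; linarith
    · right; linarith
  · exact intervalIntegral.integral_nonneg ht fun s _ => f.nonneg_normed s
  · rw [intervalIntegral.integral_of_le ht, ← f.integral_normed (μ := volume)]
    exact setIntegral_le_integral f.integrable_normed (ae_of_all _ fun s => f.nonneg_normed s)

/-- The fundamental theorem of calculus for weak derivatives: test functions approximating the
indicator of `(x, y)` turn the defining identity into `u y - u x = ∫ g`. -/
lemma IsWeakDeriv.sub_eq_integral {u g : ℝ → 𝕜} (hg : IsWeakDeriv u g)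
    (hu : ContinuousOn u (Ioi 0)) {x y : ℝ} (hx : 0 < x) (hxy : x < y) :
    u y - u x = ∫ t in x..y, g t := by
  have hy : 0 < y := hx.trans hxy
  -- radii tending to zero, small enough to keep the bumps inside `(0, ∞)`
  let r : ℕ → ℝ := fun n => x / 2 / (n + 1)
  have hr : ∀ n, 0 < r n := fun n => by positivity
  have hrx : ∀ n, r n ≤ x / 2 := fun n =>
    div_le_self (by positivity) (by linarith [n.cast_nonneg (α := ℝ)])
  have hr0 : Tendsto r atTop (𝓝 0) := by
    have := (tendsto_one_div_add_atTop_nhds_zero_nat (𝕜 := ℝ)).const_mul (x / 2)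
    simpa [r, div_eq_mul_inv] using this
  let bx : ℕ → ContDiffBump x := fun n => ⟨r n / 2, r n, by linarith [hr n], by linarith [hr n]⟩
  let dy : ℕ → ContDiffBump y := fun n => ⟨r n / 2, r n, by linarith [hr n], by linarith [hr n]⟩
  let ψ : ℕ → ℝ → ℝ := fun n t => (bx n).normed volume t - (dy n).normed volume t
  let φ : ℕ → ℝ → ℝ := fun n t => ∫ s in (0 : ℝ)..t, ψ n s
  have hcx : ∀ n, Continuous ((bx n).normed volume) := fun n =>
    ((bx n).contDiff_normed (n := 0)).continuous
  have hcy : ∀ n, Continuous ((dy n).normed volume) := fun n =>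
    ((dy n).contDiff_normed (n := 0)).continuous
  have hψs : ∀ n, ContDiff ℝ (⊤ : ℕ∞) (ψ n) := fun n =>
    (bx n).contDiff_normed.sub (dy n).contDiff_normed
  have hφd : ∀ n, deriv (φ n) = ψ n := fun n => funext fun t =>
    (hψs n).continuous.deriv_integral _ 0 t
  have hφs : ∀ n, ContDiff ℝ (⊤ : ℕ∞) (φ n) := fun n => by
    rw [contDiff_infty_iff_deriv, hφd]
    exact ⟨fun t => (intervalIntegral.integral_hasDerivAt_right
      ((hψs n).continuous.intervalIntegrable _ _)
      ((hψs n).continuous.stronglyMeasurableAtFilter _ _)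
      (hψs n).continuous.continuousAt).differentiableAt, hψs n⟩
  have hφe : ∀ n t, φ n t = (∫ s in (0 : ℝ)..t, (bx n).normed volume s)
      - ∫ s in (0 : ℝ)..t, (dy n).normed volume s := fun n t =>
    intervalIntegral.integral_sub ((hcx n).intervalIntegrable _ _) ((hcy n).intervalIntegrable _ _)
  have Bx : ∀ n, _ := fun n => integral_normed_bump_eq (bx n) (by linarith [hrx n] : r n ≤ x)
  have By : ∀ n, _ := fun n => integral_normed_bump_eq (dy n) (by linarith [hrx n] : r n ≤ y)
  have hφ0 : ∀ n t, t ∉ Icc (x - r n) (y + r n) → φ n t = 0 := by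
    intro n t ht
    rw [hφe]
    rw [mem_Icc, not_and_or, not_le, not_le] at ht
    rcases ht with ht | ht
    · rw [(Bx n).1 t ht.le, (By n).1 t (by change t ≤ y - r n; linarith), sub_zero]
    · rw [(Bx n).2.1 t (by change x + r n ≤ t; linarith), (By n).2.1 t ht.le, sub_self]
  have hts : ∀ n, tsupport (φ n) ⊆ Icc (x - r n) (y + r n) := fun n =>
    closure_minimal (fun t ht => by_contra fun h => ht (hφ0 n t h)) isClosed_Icc
  have hts' : ∀ n, tsupport (φ n) ⊆ Ioi 0 := fun n t ht => by
    have := (hts n ht).1; simp only [mem_Ioi]; linarith [hrx n]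
  have hφc : ∀ n, HasCompactSupport (φ n) := fun n =>
    isCompact_Icc.of_isClosed_subset (isClosed_tsupport _) (hts n)
  have eqn : ∀ n, (∫ t, (bx n).normed volume t • u t) - (∫ t, (dy n).normed volume t • u t)
      = - ∫ t in Ioi 0, φ n t • g t := by
    intro n
    rw [← hg.2.2 (φ n) (hφs n) (hφc n) (hts' n), hφd]
    have sx : tsupport ((bx n).normed volume) ⊆ Ioi 0 := by
      rw [(bx n).tsupport_normed_eq]; intro t ht
      rw [Metric.mem_closedBall, Real.dist_eq] at ht
      have := (abs_le.1 ht).1; change -(r n) ≤ _ at this; simp only [mem_Ioi]; linarith [hrx n]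
    have sy : tsupport ((dy n).normed volume) ⊆ Ioi 0 := by
      rw [(dy n).tsupport_normed_eq]; intro t ht
      rw [Metric.mem_closedBall, Real.dist_eq] at ht
      have := (abs_le.1 ht).1; change -(r n) ≤ _ at this; simp only [mem_Ioi]; linarith [hrx n]
    rw [← setIntegral_test_smul sx, ← setIntegral_test_smul sy]
    simp only [ψ, sub_smul]
    rw [integral_sub]
    · exact (integrable_test_smul hg.1 (hcx n) (bx n).hasCompactSupport_normed sx).integrableOn
    · exact (integrable_test_smul hg.1 (hcy n) (dy n).hasCompactSupport_normed sy).integrableOn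
  have avg : ∀ (z : ℝ) (b : ℕ → ContDiffBump z), x ≤ z → (∀ n, (b n).rOut = r n) →
      Tendsto (fun n => ∫ t, (b n).normed volume t • u t) atTop (𝓝 (u z)) := by
    intro z b hz hb
    rw [Metric.tendsto_nhds]
    intro ε hε
    have hcz : ContinuousAt u z := hu.continuousAt (Ioi_mem_nhds (by linarith))
    obtain ⟨δ, hδ, hδ'⟩ := Metric.continuousAt_iff.1 hcz (ε / 2) (by positivity)
    filter_upwards [hr0.eventually (gt_mem_nhds hδ)] with n hn
    have sz : tsupport ((b n).normed volume) ⊆ Ioi 0 := by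
      rw [(b n).tsupport_normed_eq]; intro t ht
      rw [Metric.mem_closedBall, Real.dist_eq, hb] at ht
      have := (abs_le.1 ht).1; simp only [mem_Ioi]; linarith [hrx n]
    rw [dist_eq_norm]
    refine lt_of_le_of_lt (norm_integral_normed_bump_smul_sub_le (b n) (ε := ε / 2) ?_ ?_)
      (by linarith)
    · intro t ht
      rw [← dist_eq_norm]
      refine (hδ' ?_).le
      rw [Metric.mem_ball, hb] at ht
      exact ht.trans hn
    · exact integrable_test_smul hg.1 ((b n).contDiff_normed (n := 0)).continuous
        (b n).hasCompactSupport_normed sz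
  have lim1 := (avg x bx le_rfl fun _ => rfl).sub (avg y dy hxy.le fun _ => rfl)
  simp only [eqn] at lim1
  have lim2 : Tendsto (fun n => ∫ t in Ioi 0, φ n t • g t) atTop
      (𝓝 (∫ t in Ioi 0, (Ioo x y).indicator g t)) := by
    have hJ : IntegrableOn g (Icc (x / 2) (y + x / 2)) :=
      hg.2.1.integrableOn_compact_subset (fun t ht => by
        have := ht.1; simp only [mem_Ioi]; linarith) isCompact_Icc
    refine tendsto_integral_of_dominated_convergence
      ((Icc (x / 2) (y + x / 2)).indicator fun t => ‖g t‖) ?_ ?_ ?_ ?_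
    · exact fun n => (integrable_test_smul hg.2.1 (hφs n).continuous (hφc n)
        (hts' n)).integrableOn.aestronglyMeasurable
    · exact ((integrable_indicator_iff measurableSet_Icc).2 hJ.norm).integrableOn
    · refine fun n => (ae_restrict_iff' measurableSet_Ioi).2 (ae_of_all _ fun t ht => ?_)
      have ht0 : (0 : ℝ) ≤ t := le_of_lt ht
      by_cases htI : t ∈ Icc (x / 2) (y + x / 2)
      · rw [indicator_of_mem htI, norm_smul]
        refine mul_le_of_le_one_left (norm_nonneg _) ?_
        rw [hφe, Real.norm_eq_abs, abs_le]
        have h1 := (Bx n).2.2 t ht0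
        have h2 := (By n).2.2 t ht0
        constructor <;> linarith [h1.1, h1.2, h2.1, h2.2]
      · rw [indicator_of_notMem htI, hφ0 n t, zero_smul, norm_zero]
        exact fun h => htI ⟨by linarith [h.1, hrx n], by linarith [h.2, hrx n]⟩
    · have hne : ∀ᵐ t ∂(volume : Measure ℝ), t ≠ x ∧ t ≠ y := by
        have h1 : ∀ᵐ t ∂(volume : Measure ℝ), t ≠ x := by simp [ae_iff]
        have h2 : ∀ᵐ t ∂(volume : Measure ℝ), t ≠ y := by simp [ae_iff]
        filter_upwards [h1, h2] with t a b using ⟨a, b⟩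
      filter_upwards [ae_restrict_of_ae hne] with t ht
      refine tendsto_const_nhds.congr' ?_
      by_cases htI : t ∈ Ioo x y
      · filter_upwards [hr0.eventually (gt_mem_nhds (sub_pos.2 htI.1)),
          hr0.eventually (gt_mem_nhds (sub_pos.2 htI.2))] with n h1 h2
        rw [indicator_of_mem htI, hφe, (Bx n).2.1 t (by change x + r n ≤ t; linarith),
          (By n).1 t (by change t ≤ y - r n; linarith), sub_zero, one_smul]
      · rw [indicator_of_notMem htI]
        rw [mem_Ioo, not_and_or, not_lt, not_lt] at htI
        rcases htI with h | h
        · have h' : 0 < x - t := sub_pos.2 (lt_of_le_of_ne h ht.1)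
          filter_upwards [hr0.eventually (gt_mem_nhds h')] with n h1
          rw [hφ0 n t (fun hh => by linarith [hh.1]), zero_smul]
        · have h' : 0 < t - y := sub_pos.2 (lt_of_le_of_ne h (Ne.symm ht.2))
          filter_upwards [hr0.eventually (gt_mem_nhds h')] with n h1
          rw [hφ0 n t (fun hh => by linarith [hh.2]), zero_smul]
  have e := tendsto_nhds_unique lim1 lim2.neg
  rw [setIntegral_indicator measurableSet_Ioo,
    inter_eq_right.2 (show Ioo x y ⊆ Ioi 0 from fun t ht => hx.trans ht.1),
    ← integral_Ioc_eq_integral_Ioo, ← intervalIntegral.integral_of_le hxy.le] at e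
  rw [← neg_sub, e, neg_neg]

/-- A `C¹` function on the line is weakly differentiable on the half-line. -/
lemma isWeakDeriv_of_hasDerivAt {u g : ℝ → 𝕜} (h : ∀ x, HasDerivAt u (g x) x)
    (hg : Continuous g) : IsWeakDeriv u g := by
  have hu : Continuous u := continuous_iff_continuousAt.2 fun x => (h x).continuousAt
  refine ⟨hu.locallyIntegrable.locallyIntegrableOn _, hg.locallyIntegrable.locallyIntegrableOn _,
    fun φ hφ hc hs => ?_⟩
  have hs' : tsupport (deriv φ) ⊆ Ioi 0 := fun x hx => hs (tsupport_deriv_subset hx)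
  have hd : Continuous (deriv φ) := hφ.continuous_deriv (by simp)
  rw [setIntegral_test_smul hs, setIntegral_test_smul hs']
  have i1 : Integrable fun x => φ x • g x := (hφ.continuous.smul hg).integrable_of_hasCompactSupport
    hc.smul_right
  have i2 : Integrable fun x => deriv φ x • u x := (hd.smul hu).integrable_of_hasCompactSupport
    hc.deriv.smul_right
  have e : ∫ x, (φ x • g x + deriv φ x • u x) = 0 := by
    refine integral_eq_zero_of_hasDerivAt_of_integrable (f := fun x => φ x • u x) (fun x => ?_)
      (i1.add i2) ((hφ.continuous.smul hu).integrable_of_hasCompactSupport hc.smul_right)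
    exact ((hφ.differentiable (by simp)) x).hasDerivAt.smul (h x)
  rw [integral_add i1 i2] at e
  exact eq_neg_of_add_eq_zero_right e

end WeakDerivative

/-! ### Moduli of `H¹` functions and the chain rule inequality -/

section Profile

/-- `γ` is an upper gradient of `w` on `[a, b]`: it is nonnegative, integrable, and its integrals
bound the increments of `w`. -/
structure IsUpperGradient (w γ : ℝ → ℝ) (a b : ℝ) : Prop where
  nonneg : ∀ x, 0 ≤ γ x
  intervalIntegrable : IntervalIntegrable γ volume a b
  abs_sub_le : ∀ x y, a ≤ x → x ≤ y → y ≤ b → |w y - w x| ≤ ∫ t in x..y, γ t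

lemma IsUpperGradient.absolutelyContinuous_comp {w γ : ℝ → ℝ} {a b : ℝ} (hab : a ≤ b)
    (h : IsUpperGradient w γ a b) {F : ℝ → ℝ} {C : ℝ}
    (hF : ∀ x ∈ Icc a b, ∀ y ∈ Icc a b, |F y - F x| ≤ C * |w y - w x|) :
    AbsolutelyContinuousOnInterval F a b := by
  have hΓ := h.intervalIntegrable.absolutelyContinuousOnInterval_intervalIntegral (c := a) (by simp)
  have hint : ∀ x ∈ Icc a b, IntervalIntegrable γ volume a x := fun x hx =>
    h.intervalIntegrable.mono_set (by rw [uIcc_of_le hx.1, uIcc_of_le hab]; gcongr; exact hx.2)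
  have bound : ∀ x ∈ Icc a b, ∀ y ∈ Icc a b,
      dist (F x) (F y) ≤ |C| * dist (∫ t in a..x, γ t) (∫ t in a..y, γ t) := by
    have aux : ∀ x ∈ Icc a b, ∀ y ∈ Icc a b, x ≤ y →
        dist (F x) (F y) ≤ |C| * dist (∫ t in a..x, γ t) (∫ t in a..y, γ t) := by
      intro x hx y hy hxy
      rw [dist_comm, Real.dist_eq, dist_comm, Real.dist_eq,
        intervalIntegral.integral_interval_sub_left (hint y hy) (hint x hx)]
      calc |F y - F x| ≤ C * |w y - w x| := hF x hx y hy
        _ ≤ |C| * |w y - w x| := by gcongr; exact le_abs_self C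
        _ ≤ |C| * ∫ t in x..y, γ t := by gcongr; exact h.abs_sub_le x y hx.1 hxy hy.2
        _ ≤ _ := by gcongr; exact le_abs_self _
    intro x hx y hy
    rcases le_total x y with hxy | hxy
    · exact aux x hx y hy hxy
    · rw [dist_comm, dist_comm (∫ t in a..x, γ t)]; exact aux y hy x hx hxy
  have hΓ' := hΓ.const_mul |C|
  rw [absolutelyContinuousOnInterval_iff] at hΓ ⊢
  intro ε hε
  obtain ⟨δ, hδ, H⟩ := hΓ (ε / (|C| + 1)) (by positivity)
  refine ⟨δ, hδ, fun E hE hE' => ?_⟩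
  have := H E hE hE'
  calc _ ≤ ∑ i ∈ Finset.range E.1,
        |C| * dist (∫ t in a..(E.2 i).1, γ t) (∫ t in a..(E.2 i).2, γ t) := by
        refine Finset.sum_le_sum fun i hi => ?_
        have hm := hE.1 i hi
        rw [uIcc_of_le hab] at hm
        exact bound _ hm.1 _ hm.2
    _ = |C| * ∑ i ∈ Finset.range E.1,
        dist (∫ t in a..(E.2 i).1, γ t) (∫ t in a..(E.2 i).2, γ t) := by rw [Finset.mul_sum]
    _ ≤ |C| * (ε / (|C| + 1)) := by gcongr
    _ < (|C| + 1) * (ε / (|C| + 1)) := by gcongr; linarith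
    _ = ε := by field_simp

/-- The chain rule for upper gradients: `|(Φ ∘ w)'| ≤ |Φ'(w)| γ`. -/
lemma IsUpperGradient.abs_comp_sub_le {w γ : ℝ → ℝ} {a b : ℝ} (hab : a ≤ b)
    (h : IsUpperGradient w γ a b) (hw : ContinuousOn w (Icc a b)) {Φ Φ' : ℝ → ℝ} {c d : ℝ}
    (hcd : ∀ x ∈ Icc a b, w x ∈ Icc c d) (hΦ : ∀ v ∈ Icc c d, HasDerivAt Φ (Φ' v) v)
    (hΦ' : ContinuousOn Φ' (Icc c d)) :
    |Φ (w b) - Φ (w a)| ≤ ∫ t in a..b, |Φ' (w t)| * γ t := by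
  obtain ⟨C, hC⟩ := isCompact_Icc.exists_bound_of_continuousOn (E := ℝ) hΦ'
  have hwAC : AbsolutelyContinuousOnInterval w a b :=
    h.absolutelyContinuous_comp hab (C := 1) fun x _ y _ => by rw [one_mul]
  have hFAC : AbsolutelyContinuousOnInterval (fun x => Φ (w x)) a b :=
    h.absolutelyContinuous_comp hab (C := C) fun x hx y hy =>
      Convex.norm_image_sub_le_of_norm_hasDerivWithin_le (𝕜 := ℝ) (f := Φ) (f' := Φ')
        (fun v hv => (hΦ v hv).hasDerivWithinAt) hC (convex_Icc c d) (hcd x hx) (hcd y hy)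
  have hrint : IntervalIntegrable (fun t => |Φ' (w t)| * γ t) volume a b := by
    refine h.intervalIntegrable.continuousOn_mul ?_
    rw [uIcc_of_le hab]
    exact (hΦ'.comp hw hcd).abs
  rw [← hFAC.integral_deriv_eq_sub]
  refine (intervalIntegral.norm_integral_le_integral_norm (E := ℝ) hab).trans ?_
  refine intervalIntegral.integral_mono_ae_restrict hab hFAC.intervalIntegrable_deriv.norm hrint ?_
  rw [Filter.EventuallyLE, ae_restrict_iff' measurableSet_Icc]
  have hab' : ∀ᵐ t ∂(volume : Measure ℝ), t ≠ a ∧ t ≠ b := by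
    have h1 : ∀ᵐ t ∂(volume : Measure ℝ), t ≠ a := by simp [ae_iff]
    have h2 : ∀ᵐ t ∂(volume : Measure ℝ), t ≠ b := by simp [ae_iff]
    filter_upwards [h1, h2] with t a b using ⟨a, b⟩
  filter_upwards [hwAC.ae_differentiableAt, h.intervalIntegrable.ae_hasDerivAt_integral, hab']
    with t ht1 ht2 ht3 ht
  have htu : t ∈ uIcc a b := by rwa [uIcc_of_le hab]
  have hwd := (ht1 htu).hasDerivAt
  have hΓd := ht2 htu a (by simp)
  have hnb : Icc a b ∈ 𝓝 t :=
    Icc_mem_nhds (lt_of_le_of_ne ht.1 (Ne.symm ht3.1)) (lt_of_le_of_ne ht.2 ht3.2)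
  have hint : ∀ x ∈ Icc a b, IntervalIntegrable γ volume a x := fun x hx =>
    h.intervalIntegrable.mono_set (by rw [uIcc_of_le hx.1, uIcc_of_le hab]; gcongr; exact hx.2)
  have hw' : |deriv w t| ≤ γ t := by
    rw [← abs_of_nonneg (h.nonneg t)]
    refine le_of_tendsto_of_tendsto (hasDerivAt_iff_tendsto_slope.1 hwd).abs
      (hasDerivAt_iff_tendsto_slope.1 hΓd).abs ?_
    filter_upwards [mem_nhdsWithin_of_mem_nhds hnb] with y hy
    simp only [slope_def_field, abs_div]
    refine div_le_div_of_nonneg_right ?_ (abs_nonneg _)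
    rw [intervalIntegral.integral_interval_sub_left (hint y hy) (hint t ht)]
    rcases le_total t y with hty | hty
    · exact (h.abs_sub_le t y ht.1 hty hy.2).trans (le_abs_self _)
    · rw [abs_sub_comm, intervalIntegral.integral_symm, abs_neg]
      exact (h.abs_sub_le y t hy.1 hty ht.2).trans (le_abs_self _)
  have hcomp : HasDerivAt (fun x => Φ (w x)) (Φ' (w t) * deriv w t) t :=
    (hΦ _ (hcd t ht)).comp t hwd
  change ‖deriv (fun x => Φ (w x)) t‖ ≤ |Φ' (w t)| * γ t
  rw [hcomp.deriv, norm_mul, Real.norm_eq_abs, Real.norm_eq_abs]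
  gcongr

/-- The properties shared by all pairs `(‖u‖, ‖u'‖)` with `u ∈ H¹(0, ∞)`. -/
structure IsProfile (w γ : ℝ → ℝ) : Prop where
  continuousOn : ContinuousOn w (Ici 0)
  nonneg : ∀ x, 0 ≤ w x
  grad_nonneg : ∀ x, 0 ≤ γ x
  memLp : MemLp w 2 halfLine
  grad_memLp : MemLp γ 2 halfLine
  abs_sub_le : ∀ x y, 0 ≤ x → x ≤ y → |w y - w x| ≤ ∫ t in x..y, γ t

lemma intervalIntegrable_of_memLp {E : Type*} [NormedAddCommGroup E] {g : ℝ → E}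
    (hg : MemLp g 2 halfLine) {x y : ℝ} (hx : 0 ≤ x) (hxy : x ≤ y) :
    IntervalIntegrable g volume x y := by
  rw [intervalIntegrable_iff_integrableOn_Ioc_of_le hxy]
  have h1 : MemLp g 2 (volume.restrict (Ioc x y)) :=
    hg.mono_measure (Measure.restrict_mono (fun t ht => lt_of_le_of_lt hx ht.1) le_rfl)
  exact h1.integrable (by norm_num)

lemma MemH1.exists_weakDeriv {𝕜 : Type*} [RCLike 𝕜] {u : ℝ → 𝕜} (hu : MemH1 u) :
    IsWeakDeriv u (weakDeriv u) ∧ MemLp (weakDeriv u) 2 halfLine := by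
  obtain ⟨-, -, g, hg, hg2⟩ := hu
  have h : ∃ g, IsWeakDeriv u g := ⟨g, hg⟩
  have h1 : IsWeakDeriv u (weakDeriv u) := by
    rw [weakDeriv, dif_pos h]; exact h.choose_spec
  exact ⟨h1, hg2.ae_eq (hg.ae_eq h1)⟩

/-- The fundamental theorem of calculus in `H¹(0, ∞)`, up to the boundary. -/
lemma MemH1.sub_eq_integral {𝕜 : Type*} [RCLike 𝕜] {u : ℝ → 𝕜} (hu : MemH1 u) {x y : ℝ}
    (hx : 0 ≤ x) (hxy : x ≤ y) : u y - u x = ∫ t in x..y, weakDeriv u t := by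
  obtain ⟨hw, hw2⟩ := hu.exists_weakDeriv
  have hpos : ∀ x, 0 < x → x ≤ y → u y - u x = ∫ t in x..y, weakDeriv u t := by
    intro x hx hxy
    rcases hxy.eq_or_lt with rfl | hxy
    · simp
    · exact hw.sub_eq_integral (hu.1.mono Ioi_subset_Ici_self) hx hxy
  rcases hx.eq_or_lt with rfl | hx
  · rcases hxy.eq_or_lt with rfl | hy
    · simp
    have hint := intervalIntegrable_of_memLp hw2 le_rfl hxy
    have hc : ContinuousOn (fun x => ∫ t in x..y, weakDeriv u t) (Icc 0 y) := by
      have := intervalIntegral.continuousOn_primitive_interval_left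
        (f := weakDeriv u) (a := 0) (b := y) (μ := volume) (by
          rw [uIcc_of_le hxy, integrableOn_Icc_iff_integrableOn_Ioc]
          exact (intervalIntegrable_iff_integrableOn_Ioc_of_le hxy).1 hint)
      rwa [uIcc_of_le hxy] at this
    have l1 : Tendsto (fun x => u y - u x) (𝓝[>] 0) (𝓝 (u y - u 0)) :=
      tendsto_const_nhds.sub ((hu.1 0 (by simp)).mono Ioi_subset_Ici_self)
    have l2 : Tendsto (fun x => ∫ t in x..y, weakDeriv u t) (𝓝[>] 0)
        (𝓝 (∫ t in (0 : ℝ)..y, weakDeriv u t)) := by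
      rw [← nhdsWithin_Ioo_eq_nhdsGT hy]
      exact (hc 0 ⟨le_rfl, hxy⟩).mono Ioo_subset_Icc_self
    refine tendsto_nhds_unique_of_eventuallyEq l1 l2 ?_
    filter_upwards [Ioo_mem_nhdsGT hy] with x hx
    exact hpos x hx.1 hx.2.le
  · exact hpos x hx hxy

lemma MemH1.isProfile {𝕜 : Type*} [RCLike 𝕜] {u : ℝ → 𝕜} (hu : MemH1 u) :
    IsProfile (fun x => ‖u x‖) (fun x => ‖weakDeriv u x‖) where
  continuousOn := hu.1.norm
  nonneg _ := norm_nonneg _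
  grad_nonneg _ := norm_nonneg _
  memLp := hu.2.1.norm
  grad_memLp := hu.exists_weakDeriv.2.norm
  abs_sub_le x y hx hxy := by
    refine (abs_norm_sub_norm_le _ _).trans ?_
    rw [hu.sub_eq_integral hx hxy]
    exact intervalIntegral.norm_integral_le_integral_norm hxy

variable {w γ : ℝ → ℝ}

lemma IsProfile.isUpperGradient (h : IsProfile w γ) {a b : ℝ} (ha : 0 ≤ a) (hab : a ≤ b) :
    IsUpperGradient w γ a b where
  nonneg := h.grad_nonneg
  intervalIntegrable := intervalIntegrable_of_memLp h.grad_memLp ha hab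
  abs_sub_le x y hx hxy _ := h.abs_sub_le x y (ha.trans hx) hxy

lemma IsProfile.integrable_sq (h : IsProfile w γ) : IntegrableOn (fun x => w x ^ 2) (Ioi 0) :=
  h.memLp.integrable_sq

lemma IsProfile.integrable_mul (h : IsProfile w γ) : IntegrableOn (fun x => w x * γ x) (Ioi 0) :=
  h.memLp.integrable_mul h.grad_memLp

lemma IsProfile.abs_comp_sub_le (h : IsProfile w γ) {a b : ℝ} (ha : 0 ≤ a) (hab : a ≤ b)
    {Φ Φ' : ℝ → ℝ} (hΦ : ∀ v, HasDerivAt Φ (Φ' v) v) (hΦ' : Continuous Φ') :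
    |Φ (w b) - Φ (w a)| ≤ ∫ t in a..b, |Φ' (w t)| * γ t := by
  have hc : ContinuousOn w (Icc a b) := h.continuousOn.mono fun x hx => ha.trans hx.1
  obtain ⟨C, hC⟩ := isCompact_Icc.exists_bound_of_continuousOn hc
  exact (h.isUpperGradient ha hab).abs_comp_sub_le hab hc (c := -C) (d := C)
    (fun x hx => abs_le.1 (hC x hx)) (fun v _ => hΦ v) hΦ'.continuousOn

/-- Square integrable functions come close to zero arbitrarily far out. -/
lemma IsProfile.exists_small (h : IsProfile w γ) {ε : ℝ} (hε : 0 < ε) (X : ℝ) :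
    ∃ y, X ≤ y ∧ 0 ≤ y ∧ w y ^ 2 < ε := by
  by_contra! hcon
  have hi : IntegrableOn (fun x => w x ^ 2) (Ioi (max X 0)) :=
    h.integrable_sq.mono_set (Ioi_subset_Ioi (le_max_right _ _))
  have hc : IntegrableOn (fun _ => ε) (Ioi (max X 0)) := by
    refine Integrable.mono' hi aestronglyMeasurable_const
      ((ae_restrict_iff' measurableSet_Ioi).2 (ae_of_all _ fun x hx => ?_))
    rw [Real.norm_of_nonneg hε.le]
    have hx' : max X 0 < x := hx
    exact hcon x ((le_max_left _ _).trans hx'.le) ((le_max_right _ _).trans hx'.le)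
  rw [integrableOn_const_iff] at hc
  simp [hε.ne'] at hc

/-- `H¹` functions vanish at infinity. -/
lemma IsProfile.tendsto_zero (h : IsProfile w γ) : Tendsto w atTop (𝓝 0) := by
  have key : ∀ x y, 0 ≤ x → x ≤ y → |w y ^ 2 - w x ^ 2| ≤ ∫ t in Ioi x, 2 * (w t * γ t) := by
    intro x y hx hxy
    have hsub : Ioi x ⊆ Ioi 0 := Ioi_subset_Ioi hx
    have hI : IntegrableOn (fun t => 2 * (w t * γ t)) (Ioi x) :=
      (h.integrable_mul.mono_set hsub).const_mul 2
    refine (h.abs_comp_sub_le hx hxy (Φ := fun v => v ^ 2) (Φ' := fun v => 2 * v)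
      (fun v => by simpa using hasDerivAt_pow 2 v) (by fun_prop)).trans ?_
    rw [intervalIntegral.integral_of_le hxy]
    simp only [abs_mul, abs_two, abs_of_nonneg (h.nonneg _), mul_assoc]
    refine setIntegral_mono_set hI (ae_of_all _ fun t => ?_) Ioc_subset_Ioi_self.eventuallyLE
    have := h.nonneg t; have := h.grad_nonneg t; positivity
  have hlim : Tendsto (fun x => ∫ t in Ioi x, 2 * (w t * γ t)) atTop (𝓝 0) :=
    tendsto_integral_Ioi_zero (f := fun t => 2 * (w t * γ t)) (μ := volume) tendsto_id
  have hsq : Tendsto (fun x => w x ^ 2) atTop (𝓝 0) := by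
    rw [Metric.tendsto_nhds]
    intro ε hε
    filter_upwards [hlim.eventually (gt_mem_nhds (half_pos hε)), eventually_ge_atTop 0]
      with x hx hx0
    obtain ⟨y, hxy, -, hy⟩ := h.exists_small (half_pos hε) x
    have := (abs_le.1 (key x y hx0 hxy)).1
    rw [Real.dist_eq, sub_zero, abs_of_nonneg (sq_nonneg _)]
    linarith
  have := hsq.sqrt
  simpa [Real.sqrt_sq (h.nonneg _)] using this

/-- The modulus of a nonzero `H¹` function attains its maximum. -/
lemma IsProfile.exists_max (h : IsProfile w γ) (hpos : 0 < ∫ x in Ioi 0, w x ^ 2) :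
    ∃ x₀, 0 ≤ x₀ ∧ 0 < w x₀ ∧ ∀ x, 0 ≤ x → w x ≤ w x₀ := by
  obtain ⟨x₁, hx₁, hw₁⟩ : ∃ x₁, 0 ≤ x₁ ∧ 0 < w x₁ := by
    by_contra! hcon
    refine hpos.ne' ?_
    rw [setIntegral_congr_fun (g := fun _ => (0 : ℝ)) measurableSet_Ioi, integral_zero]
    intro x hx
    have := le_antisymm (hcon x (le_of_lt hx)) (h.nonneg x)
    simp [this]
  obtain ⟨X, hX⟩ := (h.tendsto_zero.eventually (gt_mem_nhds hw₁)).exists_forall_of_atTop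
  have hm : (0 : ℝ) ≤ max X x₁ := hx₁.trans (le_max_right _ _)
  obtain ⟨x₀, hx₀, hmax⟩ := isCompact_Icc.exists_isMaxOn (s := Icc 0 (max X x₁)) ⟨0, by simp [hm]⟩
    (h.continuousOn.mono fun x hx => hx.1)
  have h1 : w x₁ ≤ w x₀ := hmax ⟨hx₁, le_max_right _ _⟩
  refine ⟨x₀, hx₀.1, hw₁.trans_le h1, fun x hx => ?_⟩
  by_cases hxX : x ≤ max X x₁
  · exact hmax ⟨hx, hxX⟩
  · exact ((hX x ((le_max_left _ _).trans (not_le.1 hxX).le)).le).trans h1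

lemma IsProfile.rpow_integrable (h : IsProfile w γ) {p : ℝ} (hp : 2 < p) :
    IntegrableOn (fun x => w x ^ p) (Ioi 0) := by
  by_cases hpos : 0 < ∫ x in Ioi 0, w x ^ 2
  · obtain ⟨x₀, -, hx₀, hmax⟩ := h.exists_max hpos
    refine Integrable.mono' (h.integrable_sq.const_mul (w x₀ ^ (p - 2))) ?_
      ((ae_restrict_iff' measurableSet_Ioi).2 (ae_of_all _ fun x hx => ?_))
    · exact (h.memLp.1.aemeasurable.pow_const p).aestronglyMeasurable
    · have hx' : (0 : ℝ) ≤ x := le_of_lt hx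
      rw [Real.norm_of_nonneg (Real.rpow_nonneg (h.nonneg x) p)]
      rcases (h.nonneg x).eq_or_lt with h0 | h0
      · rw [← h0, Real.zero_rpow (by linarith)]; simp
      · have e : w x ^ p = w x ^ (p - 2) * w x ^ 2 := by
          rw [← Real.rpow_natCast, ← Real.rpow_add h0]; norm_num
        rw [e]
        gcongr
        exact hmax x hx'
  · have h0 : ∫ x in Ioi 0, w x ^ 2 = 0 :=
      le_antisymm (not_lt.1 hpos) (integral_nonneg fun x => sq_nonneg _)
    rw [integral_eq_zero_iff_of_nonneg (fun x => sq_nonneg _) h.integrable_sq] at h0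
    refine (integrable_zero _ _ _).congr ?_
    filter_upwards [h0] with x hx
    have : w x = 0 := by simpa using hx
    simp [this, Real.zero_rpow (by linarith : p ≠ 0)]

end Profile

/-! ### Action and mass as functions of the frequency -/

section Action

/-- The truncated power `(ω - y²)₊ ^ N`. -/
noncomputable def posPow (N ω y : ℝ) : ℝ := (max (ω - y ^ 2) 0) ^ N

/-- Up to the factor `(p/2)^N / 2`, the least action at frequency `ω`, where `N = 2 / (p - 2)`. -/
noncomputable def action (α N ω : ℝ) : ℝ := ∫ y in (-α)..√ω, posPow N ω y

/-- Up to the factor `N (p/2)^N`, the mass of the least action state at frequency `ω`: the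
derivative of the action, up to normalization. -/
noncomputable def massIntegral (α N ω : ℝ) : ℝ := ∫ y in (-min α √ω)..√ω, (ω - y ^ 2) ^ (N - 1)

variable {N α ω ω₀ : ℝ}

lemma continuous_posPow (hN : 0 ≤ N) : Continuous (posPow N ω) := by
  unfold posPow
  exact ((by fun_prop : Continuous fun y : ℝ => max (ω - y ^ 2) 0)).rpow_const fun _ => Or.inr hN

lemma posPow_nonneg (N ω y : ℝ) : 0 ≤ posPow N ω y := Real.rpow_nonneg (le_max_right _ _) _

lemma posPow_neg (N ω y : ℝ) : posPow N ω (-y) = posPow N ω y := by simp [posPow]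

lemma posPow_of_sq_le {y : ℝ} (hy : y ^ 2 ≤ ω) : posPow N ω y = (ω - y ^ 2) ^ N := by
  rw [posPow, max_eq_left (by linarith)]

lemma posPow_of_le_sq (hN : 0 < N) {y : ℝ} (hy : ω ≤ y ^ 2) : posPow N ω y = 0 := by
  rw [posPow, max_eq_right (by linarith), Real.zero_rpow hN.ne']

lemma posPow_pos {y : ℝ} (hy : y ^ 2 < ω) : 0 < posPow N ω y := by
  rw [posPow_of_sq_le hy.le]; exact Real.rpow_pos_of_pos (by linarith) _

lemma posPow_anti (hN : 0 ≤ N) {x y : ℝ} (hx : 0 ≤ x) (hxy : x ≤ y) :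
    posPow N ω y ≤ posPow N ω x := by
  unfold posPow; gcongr

lemma posPow_strictAnti (hN : 0 < N) {x y : ℝ} (hx : 0 ≤ x) (hxy : x < y) (hω : x ^ 2 < ω) :
    posPow N ω y < posPow N ω x := by
  unfold posPow
  refine Real.rpow_lt_rpow (le_max_right _ _) ?_ hN
  rw [max_eq_left (by linarith : (0 : ℝ) ≤ ω - x ^ 2)]
  refine max_lt ?_ (by linarith)
  have : x ^ 2 < y ^ 2 := by gcongr
  linarith

/-- A power with exponent at least one lies above its tangents. -/
lemma rpow_tangent_le (hN : 1 ≤ N) {s t : ℝ} (hs : 0 ≤ s) (ht : 0 ≤ t) :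
    s ^ N + N * s ^ (N - 1) * (t - s) ≤ t ^ N := by
  rcases hs.eq_or_lt with rfl | hs
  · rcases hN.eq_or_lt with rfl | hN
    · simp
    · rw [Real.zero_rpow (by linarith), Real.zero_rpow (by linarith)]
      simpa using Real.rpow_nonneg ht N
  · have h1 := one_add_mul_self_le_rpow_one_add (s := t / s - 1) (p := N)
      (by have : 0 ≤ t / s := by positivity
          linarith) hN
    have e : (1 + (t / s - 1)) ^ N = t ^ N / s ^ N := by
      rw [add_sub_cancel, Real.div_rpow ht hs.le]
    rw [e, le_div_iff₀ (Real.rpow_pos_of_pos hs N)] at h1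
    have e2 : s ^ N = s ^ (N - 1) * s := by
      rw [← Real.rpow_add_one hs.ne']; ring_nf
    calc _ = (1 + N * (t / s - 1)) * s ^ N := by rw [e2]; field_simp
      _ ≤ _ := h1

lemma posPow_tangent_le (hN : 1 ≤ N) {y : ℝ} (hy : y ^ 2 ≤ ω₀) :
    (ω₀ - y ^ 2) ^ N + (ω - ω₀) * (N * (ω₀ - y ^ 2) ^ (N - 1)) ≤ posPow N ω y := by
  have hs : 0 ≤ ω₀ - y ^ 2 := by linarith
  refine le_trans ?_ (rpow_tangent_le hN hs (le_max_right (ω - y ^ 2) 0))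
  have h1 : 0 ≤ N * (ω₀ - y ^ 2) ^ (N - 1) := mul_nonneg (by linarith) (Real.rpow_nonneg hs _)
  have h2 : ω - ω₀ ≤ max (ω - y ^ 2) 0 - (ω₀ - y ^ 2) := by linarith [le_max_left (ω - y ^ 2) 0]
  nlinarith [mul_le_mul_of_nonneg_left h2 h1]

lemma sq_le_of_mem_uIcc (hω : 0 < ω) {y : ℝ} (hy : y ∈ Icc (-min α √ω) √ω) : y ^ 2 ≤ ω := by
  have h : y ^ 2 ≤ √ω ^ 2 := sq_le_sq' (by linarith [hy.1, min_le_right α √ω]) hy.2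
  rwa [Real.sq_sqrt hω.le] at h

lemma neg_min_le (hα : 0 < α) : -min α √ω ≤ √ω := by
  have := le_min hα.le (Real.sqrt_nonneg ω)
  linarith [Real.sqrt_nonneg ω]

/-- The part of the range of integration beyond `-√ω` does not contribute to the action. -/
lemma action_eq (hN : 0 < N) (hα : 0 < α) (hω : 0 < ω) :
    action α N ω = ∫ y in (-min α √ω)..√ω, (ω - y ^ 2) ^ N := by
  have hi : ∀ a b, IntervalIntegrable (posPow N ω) volume a b := fun a b =>
    (continuous_posPow hN.le).intervalIntegrable _ _
  have h2 : ∫ y in (-min α √ω)..√ω, posPow N ω y = ∫ y in (-min α √ω)..√ω, (ω - y ^ 2) ^ N := by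
    refine intervalIntegral.integral_congr fun y hy => ?_
    rw [uIcc_of_le (neg_min_le hα)] at hy
    exact posPow_of_sq_le (sq_le_of_mem_uIcc hω hy)
  have h1 : ∫ y in (-α)..(-min α √ω), posPow N ω y = 0 := by
    rcases le_total α √ω with h | h
    · rw [min_eq_left h, intervalIntegral.integral_same]
    · rw [intervalIntegral.integral_congr (g := fun _ => (0 : ℝ)), intervalIntegral.integral_zero]
      intro y hy
      rw [min_eq_right h, uIcc_of_le (by linarith)] at hy
      refine posPow_of_le_sq hN ?_
      rw [← Real.sq_sqrt hω.le]
      nlinarith [hy.2, Real.sqrt_nonneg ω]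
  rw [action, ← intervalIntegral.integral_add_adjacent_intervals (hi _ (-min α √ω)) (hi _ _), h1,
    zero_add, h2]

/-- Truncating the range of integration at another frequency decreases the action. -/
lemma integral_posPow_le_action (hN : 0 < N) (hω : 0 < ω) :
    ∫ y in (-min α √ω₀)..√ω₀, posPow N ω y ≤ action α N ω := by
  have hi : ∀ a b, IntervalIntegrable (posPow N ω) volume a b := fun a b =>
    (continuous_posPow hN.le).intervalIntegrable _ _
  have hz : ∀ a b, a ≤ b → 0 ≤ ∫ y in a..b, posPow N ω y := fun a b hab =>
    intervalIntegral.integral_nonneg hab fun y _ => posPow_nonneg N ω y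
  have e1 := intervalIntegral.integral_add_adjacent_intervals (hi (-α) (-min α √ω₀))
    (hi (-min α √ω₀) √ω₀)
  have e2 := intervalIntegral.integral_add_adjacent_intervals (hi (-α) √ω) (hi √ω √ω₀)
  have h1 := hz (-α) (-min α √ω₀) (by linarith [min_le_left α √ω₀])
  have h2 : ∫ y in √ω..√ω₀, posPow N ω y ≤ 0 := by
    rcases le_total √ω₀ √ω with h | h
    · rw [intervalIntegral.integral_symm]; linarith [hz _ _ h]
    · rw [intervalIntegral.integral_congr (g := fun _ => (0 : ℝ)), intervalIntegral.integral_zero]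
      intro y hy
      rw [uIcc_of_le h] at hy
      refine posPow_of_le_sq hN ?_
      rw [← Real.sq_sqrt hω.le]
      have := hy.1
      gcongr
  rw [action]
  linarith

/-- The action lies above its tangents, whose slopes are given by the mass, and strictly so away
from the point of tangency. -/
lemma action_tangent_lt (hN : 1 ≤ N) (hα : 0 < α) (hω : 0 < ω) (hω₀ : 0 < ω₀) (hne : ω ≠ ω₀) :
    action α N ω₀ + (ω - ω₀) * (N * massIntegral α N ω₀) < action α N ω := by
  have hN0 : 0 < N := by linarith
  have hi : ∀ a b, IntervalIntegrable (posPow N ω) volume a b := fun a b =>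
    (continuous_posPow hN0.le).intervalIntegrable _ _
  have hle := neg_min_le (ω := ω₀) hα
  let f : ℝ → ℝ := fun y => (ω₀ - y ^ 2) ^ N + (ω - ω₀) * (N * (ω₀ - y ^ 2) ^ (N - 1))
  have hc1 : Continuous fun y : ℝ => (ω₀ - y ^ 2) ^ N :=
    (by fun_prop : Continuous fun y : ℝ => ω₀ - y ^ 2).rpow_const fun _ => Or.inr hN0.le
  have hc2 : Continuous fun y : ℝ => (ω₀ - y ^ 2) ^ (N - 1) :=
    (by fun_prop : Continuous fun y : ℝ => ω₀ - y ^ 2).rpow_const fun _ => Or.inr (by linarith)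
  have hcf : Continuous f := hc1.add ((hc2.const_mul N).const_mul (ω - ω₀))
  have ef : action α N ω₀ + (ω - ω₀) * (N * massIntegral α N ω₀)
      = ∫ y in (-min α √ω₀)..√ω₀, f y := by
    rw [action_eq hN0 hα hω₀, massIntegral, intervalIntegral.integral_add
      (hc1.intervalIntegrable _ _) (((hc2.const_mul N).const_mul (ω - ω₀)).intervalIntegrable _ _),
      intervalIntegral.integral_const_mul, intervalIntegral.integral_const_mul]
  have hfle : ∀ y ∈ Icc (-min α √ω₀) √ω₀, f y ≤ posPow N ω y := fun y hy =>
    posPow_tangent_le hN (sq_le_of_mem_uIcc hω₀ hy)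
  rw [ef]
  rcases lt_or_gt_of_ne hne with h | h
  · -- between `√ω` and `√ω₀` the truncated power vanishes while the tangent is negative
    refine lt_of_lt_of_le ?_ (integral_posPow_le_action (ω₀ := ω₀) hN0 hω)
    have hs : √ω < √ω₀ := Real.sqrt_lt_sqrt hω.le h
    obtain ⟨y, hy1, hy2⟩ := exists_between hs
    have hyI : y ∈ Icc (-min α √ω₀) √ω₀ :=
      ⟨by have := le_min hα.le (Real.sqrt_nonneg ω₀); linarith [Real.sqrt_nonneg ω], hy2.le⟩
    have hlt : -min α √ω₀ < √ω₀ := by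
      have := le_min hα.le (Real.sqrt_nonneg ω₀); linarith [Real.sqrt_nonneg ω]
    refine intervalIntegral.integral_lt_integral_of_continuousOn_of_le_of_exists_lt hlt
      hcf.continuousOn (continuous_posPow hN0.le).continuousOn
      (fun y hy => hfle y (Ioc_subset_Icc_self hy)) ⟨y, hyI, ?_⟩
    have hy0 : 0 ≤ y := (Real.sqrt_nonneg ω).trans hy1.le
    have a1 : ω < y ^ 2 := (Real.sqrt_lt' (lt_of_le_of_lt (Real.sqrt_nonneg ω) hy1)).1 hy1
    have a2 : y ^ 2 < ω₀ := (Real.lt_sqrt hy0).1 hy2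
    rw [posPow_of_le_sq hN0 a1.le]
    have hs0 : 0 < ω₀ - y ^ 2 := by linarith
    have e : f y = (ω₀ - y ^ 2) ^ (N - 1) * ((ω₀ - y ^ 2) + N * (ω - ω₀)) := by
      have : (ω₀ - y ^ 2) ^ N = (ω₀ - y ^ 2) ^ (N - 1) * (ω₀ - y ^ 2) := by
        rw [← Real.rpow_add_one hs0.ne']; ring_nf
      simp only [f, this]; ring
    rw [e]
    refine mul_neg_of_pos_of_neg (Real.rpow_pos_of_pos hs0 _) ?_
    nlinarith
  · -- the piece of the action between `√ω₀` and `√ω` is not accounted for by the tangent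
    have hs : √ω₀ < √ω := Real.sqrt_lt_sqrt hω₀.le h
    have h1 : ∫ y in (-min α √ω₀)..√ω₀, f y ≤ ∫ y in (-min α √ω₀)..√ω₀, posPow N ω y :=
      intervalIntegral.integral_mono_on hle (hcf.intervalIntegrable _ _) (hi _ _) hfle
    have h2 : 0 < ∫ y in √ω₀..√ω, posPow N ω y := by
      refine intervalIntegral.intervalIntegral_pos_of_pos_on (hi _ _) (fun y hy => ?_) hs
      exact posPow_pos ((Real.lt_sqrt ((Real.sqrt_nonneg ω₀).trans hy.1.le)).1 hy.2)
    have e1 := intervalIntegral.integral_add_adjacent_intervals (hi (-α) (-min α √ω₀))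
      (hi (-min α √ω₀) √ω₀)
    have e2 := intervalIntegral.integral_add_adjacent_intervals (hi (-α) √ω₀) (hi √ω₀ √ω)
    have h3 : 0 ≤ ∫ y in (-α)..(-min α √ω₀), posPow N ω y :=
      intervalIntegral.integral_nonneg (by linarith [min_le_left α √ω₀])
        fun y _ => posPow_nonneg N ω y
    rw [action]
    linarith

/-- The slope at which the boundary term is optimal: `x = α`, or `x = √ω` if `α` is larger. -/
lemma integral_posPow_le_boundary (hN : 0 < N) (hα : 0 < α) {x : ℝ} (hx : 0 ≤ x)
    (hxω : x ≤ √ω) :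
    ∫ y in (0 : ℝ)..α, posPow N ω y ≤ (∫ y in (0 : ℝ)..x, posPow N ω y) + (α - x) * posPow N ω x ∧
    (x ≠ min α √ω →
      ∫ y in (0 : ℝ)..α, posPow N ω y
        < (∫ y in (0 : ℝ)..x, posPow N ω y) + (α - x) * posPow N ω x) := by
  have hc := continuous_posPow (ω := ω) hN.le
  have hi : ∀ a b, IntervalIntegrable (posPow N ω) volume a b := fun a b =>
    hc.intervalIntegrable _ _
  have e := intervalIntegral.integral_add_adjacent_intervals (hi 0 x) (hi x α)
  have ec : ∀ a b, ∫ _ in a..b, posPow N ω x = (b - a) * posPow N ω x := fun a b => by simp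
  rw [← e]
  rcases lt_trichotomy x α with h | h | h
  · have hle : ∀ y ∈ Ioc x α, posPow N ω y ≤ posPow N ω x := fun y hy =>
      posPow_anti hN.le hx hy.1.le
    constructor
    · have := intervalIntegral.integral_mono_on h.le (hi x α) (intervalIntegrable_const)
        (fun y hy => posPow_anti (ω := ω) hN.le hx hy.1)
      rw [ec] at this; linarith
    · intro hne
      have hlt : x < √ω := lt_of_le_of_ne hxω fun hh => hne (by rw [min_eq_right (hh ▸ h.le), hh])
      have := intervalIntegral.integral_lt_integral_of_continuousOn_of_le_of_exists_lt h
        hc.continuousOn continuousOn_const hle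
        ⟨α, ⟨h.le, le_rfl⟩, posPow_strictAnti hN hx h ((Real.lt_sqrt hx).1 hlt)⟩
      rw [ec] at this; linarith
  · subst h
    rw [min_eq_left hxω]
    simp
  · have hle : ∀ y ∈ Ioc α x, posPow N ω x ≤ posPow N ω y := fun y hy =>
      posPow_anti hN.le (hα.le.trans hy.1.le) hy.2
    have := intervalIntegral.integral_lt_integral_of_continuousOn_of_le_of_exists_lt h
        continuousOn_const hc.continuousOn hle
        ⟨α, ⟨le_rfl, h.le⟩, posPow_strictAnti hN hα.le h
          ((Real.lt_sqrt hα.le).1 (h.trans_le hxω))⟩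
    rw [ec] at this
    rw [intervalIntegral.integral_symm α x]
    exact ⟨by linarith, fun _ => by linarith⟩

lemma action_eq_add (hN : 0 ≤ N) :
    action α N ω = (∫ y in (0 : ℝ)..√ω, posPow N ω y) + ∫ y in (0 : ℝ)..α, posPow N ω y := by
  have hi : ∀ a b, IntervalIntegrable (posPow N ω) volume a b := fun a b =>
    (continuous_posPow hN).intervalIntegrable _ _
  have h := intervalIntegral.integral_comp_neg (a := 0) (b := α) (posPow N ω)
  simp only [posPow_neg, neg_zero] at h
  rw [action, h, add_comm, intervalIntegral.integral_add_adjacent_intervals (hi _ _) (hi _ _)]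

end Action

/-! ### Hyperbolic tangent -/

section Tanh

lemma hasDerivAt_tanh (x : ℝ) : HasDerivAt Real.tanh (1 - Real.tanh x ^ 2) x := by
  have h := (Real.hasDerivAt_sinh x).div (Real.hasDerivAt_cosh x) (Real.cosh_pos x).ne'
  have e : (fun x => Real.sinh x / Real.cosh x) = Real.tanh := by
    ext y; rw [Real.tanh_eq_sinh_div_cosh]
  have h' := h.congr_deriv (g' := 1 - Real.tanh x ^ 2) ?_
  · exact e ▸ h'
  rw [Real.tanh_eq_sinh_div_cosh]
  have := (Real.cosh_pos x).ne'
  field_simp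

lemma tanh_strictMono : StrictMono Real.tanh := fun x y hxy => by
  have h : ∀ z : ℝ, Real.tanh z ∈ Ioo (-1 : ℝ) 1 := fun z =>
    ⟨Real.neg_one_lt_tanh z, Real.tanh_lt_one z⟩
  rw [← Real.artanh_lt_artanh_iff (h x) (h y), Real.artanh_tanh, Real.artanh_tanh]
  exact hxy

lemma tendsto_tanh_atTop : Tendsto Real.tanh atTop (𝓝 1) := by
  refine tendsto_order.2 ⟨fun a ha => ?_, fun a ha => Eventually.of_forall fun x =>
    (Real.tanh_lt_one x).trans ha⟩
  rcases le_or_gt a (-1) with h | h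
  · exact Eventually.of_forall fun x => h.trans_lt (Real.neg_one_lt_tanh x)
  · filter_upwards [eventually_gt_atTop (Real.artanh a)] with x hx
    rw [← Real.tanh_artanh ⟨h, ha⟩]
    exact tanh_strictMono hx

lemma inv_cosh_sq (x : ℝ) : (1 / Real.cosh x) ^ 2 = 1 - Real.tanh x ^ 2 := by
  rw [Real.tanh_eq_sinh_div_cosh]
  have h := Real.cosh_sq x
  have := (Real.cosh_pos x).ne'
  field_simp
  linarith

lemma hasDerivAt_artanh {x : ℝ} (hx : x ∈ Ioo (-1 : ℝ) 1) :
    HasDerivAt Real.artanh (1 / (1 - x ^ 2)) x := by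
  have h1 : 0 < 1 - x ^ 2 := by nlinarith [hx.1, hx.2]
  have hd := hasDerivAt_tanh (Real.artanh x)
  rw [Real.tanh_artanh hx] at hd
  have hcont : ContinuousAt Real.artanh x :=
    (Real.strictMonoOn_artanh.continuousAt_of_image_mem_nhds (isOpen_Ioo.mem_nhds hx)
      (by rw [Real.artanh_bijOn.image_eq]; exact univ_mem))
  have := hd.of_local_left_inverse hcont h1.ne'
    (by filter_upwards [isOpen_Ioo.mem_nhds hx] with y hy using Real.tanh_artanh hy)
  simpa using this

end Tanh

/-! ### The soliton and the associated potential -/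

section Soliton

/-- The exponent `N = 2 / (p - 2)`; it is at least one precisely when `p ≤ 4`. -/
noncomputable def expo (p : ℝ) : ℝ := 2 / (p - 2)

/-- The factor `K = (p / 2) ^ N`. -/
noncomputable def coef (p : ℝ) : ℝ := (p / 2) ^ expo p

/-- The maximum of the soliton of frequency `ω`. -/
noncomputable def amplitude (p ω : ℝ) : ℝ := (p / 2 * ω) ^ (1 / (p - 2))

/-- The modulus `√(ω - (2/p) v^(p-2))` of the logarithmic derivative of the soliton at height
`v`. -/
noncomputable def slopeAt (p ω v : ℝ) : ℝ := √(ω - 2 / p * v ^ (p - 2))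

/-- The potential `∫₀^v s √(ω - (2/p) s^(p-2)) ds`, whose increments bound the action of a monotone
transition between two heights. -/
noncomputable def potential (p ω v : ℝ) : ℝ := ∫ s in (0 : ℝ)..v, s * slopeAt p ω s

/-- The negative `√ω tanh ((p/2 - 1) √ω x)` of the logarithmic derivative of the soliton. -/
noncomputable def solitonSlope (p ω x : ℝ) : ℝ := √ω * Real.tanh ((p / 2 - 1) * √ω * x)

variable {p ω : ℝ}

lemma expo_pos (hp : 2 < p) : 0 < expo p := div_pos two_pos (by linarith)

lemma one_le_expo (hp : 2 < p) (hp4 : p ≤ 4) : 1 ≤ expo p := by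
  rw [expo, le_div_iff₀ (by linarith)]; linarith

lemma coef_pos (hp : 2 < p) : 0 < coef p := Real.rpow_pos_of_pos (by linarith) _

lemma sub_two_mul_expo (hp : 2 < p) : (p - 2) * expo p = 2 := by
  rw [expo]; have : p - 2 ≠ 0 := by linarith
  field_simp

lemma rate_mul_expo (hp : 2 < p) (ω : ℝ) : (p / 2 - 1) * √ω * expo p = √ω := by
  have := sub_two_mul_expo hp
  linear_combination (√ω / 2) * this

lemma amplitude_pos (hp : 2 < p) (hω : 0 < ω) : 0 < amplitude p ω :=
  Real.rpow_pos_of_pos (by have : 0 < p := by linarith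
                           positivity) _

lemma amplitude_rpow (hp : 2 < p) (hω : 0 < ω) : amplitude p ω ^ (p - 2) = p / 2 * ω := by
  have h0 : 0 ≤ p / 2 * ω := by have : 0 < p := by linarith
                                positivity
  rw [amplitude, ← Real.rpow_mul h0, one_div_mul_cancel (by linarith), Real.rpow_one]

lemma continuous_slopeAt (hp : 2 < p) (ω : ℝ) : Continuous (slopeAt p ω) :=
  (continuous_const.sub (continuous_const.mul
    (Real.continuous_rpow_const (by linarith)))).sqrt

lemma slopeAt_le (hp : 2 < p) {v : ℝ} (hv : 0 ≤ v) : slopeAt p ω v ≤ √ω := by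
  refine Real.sqrt_le_sqrt ?_
  have : 0 ≤ 2 / p * v ^ (p - 2) := mul_nonneg (div_nonneg two_pos.le (by linarith))
    (Real.rpow_nonneg hv _)
  linarith

lemma slopeAt_zero (hp : 2 < p) : slopeAt p ω 0 = √ω := by
  rw [slopeAt, Real.zero_rpow (by linarith), mul_zero, sub_zero]

lemma two_div_mul_rpow_le (hp : 2 < p) (hω : 0 < ω) {v : ℝ} (hv : 0 ≤ v)
    (hva : v ≤ amplitude p ω) : 2 / p * v ^ (p - 2) ≤ ω := by
  have h1 : v ^ (p - 2) ≤ p / 2 * ω := by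
    rw [← amplitude_rpow hp hω]; exact Real.rpow_le_rpow hv hva (by linarith)
  have h2 : 0 < p := by linarith
  calc 2 / p * v ^ (p - 2) ≤ 2 / p * (p / 2 * ω) := by gcongr
    _ = ω := by field_simp

lemma two_div_mul_rpow_lt (hp : 2 < p) (hω : 0 < ω) {v : ℝ} (hv : 0 ≤ v)
    (hva : v < amplitude p ω) : 2 / p * v ^ (p - 2) < ω := by
  have h1 : v ^ (p - 2) < p / 2 * ω := by
    rw [← amplitude_rpow hp hω]; exact Real.rpow_lt_rpow hv hva (by linarith)
  have h2 : 0 < p := by linarith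
  calc 2 / p * v ^ (p - 2) < 2 / p * (p / 2 * ω) := by gcongr
    _ = ω := by field_simp

lemma slopeAt_amplitude (hp : 2 < p) (hω : 0 < ω) : slopeAt p ω (amplitude p ω) = 0 := by
  have : 0 < p := by linarith
  rw [slopeAt, amplitude_rpow hp hω, show ω - 2 / p * (p / 2 * ω) = 0 by field_simp; ring,
    Real.sqrt_zero]

lemma slopeAt_sq (hp : 2 < p) (hω : 0 < ω) {v : ℝ} (hv : 0 ≤ v) (hva : v ≤ amplitude p ω) :
    slopeAt p ω v ^ 2 = ω - 2 / p * v ^ (p - 2) :=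
  Real.sq_sqrt (by linarith [two_div_mul_rpow_le hp hω hv hva])

lemma hasDerivAt_potential (hp : 2 < p) (v : ℝ) :
    HasDerivAt (potential p ω) (v * slopeAt p ω v) v := by
  have hc : Continuous fun s => s * slopeAt p ω s := continuous_id.mul (continuous_slopeAt hp ω)
  exact intervalIntegral.integral_hasDerivAt_right (hc.intervalIntegrable _ _)
    (hc.stronglyMeasurableAtFilter _ _) hc.continuousAt

/-- The height as a function of the slope. -/
lemma sq_eq_coef_mul_rpow (hp : 2 < p) {v x : ℝ} (hv : 0 ≤ v)
    (h : x ^ 2 = ω - 2 / p * v ^ (p - 2)) : v ^ 2 = coef p * (ω - x ^ 2) ^ expo p := by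
  have hp0 : 0 < p := by linarith
  have hvp : 0 ≤ v ^ (p - 2) := Real.rpow_nonneg hv _
  have e : ω - x ^ 2 = 2 / p * v ^ (p - 2) := by linarith
  rw [e, coef, ← Real.mul_rpow (by positivity) (by positivity),
    show p / 2 * (2 / p * v ^ (p - 2)) = v ^ (p - 2) by field_simp, ← Real.rpow_mul hv,
    sub_two_mul_expo hp]
  norm_cast

/-- The cost of the transition from height `b` to the maximal height, with the slope as variable of
integration. -/
lemma potential_amplitude_sub (hp : 2 < p) (hω : 0 < ω) {b : ℝ} (hb : 0 ≤ b)
    (hba : b ≤ amplitude p ω) :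
    potential p ω (amplitude p ω) - potential p ω b
      = coef p / 2 * (∫ y in (0 : ℝ)..slopeAt p ω b, posPow (expo p) ω y)
        - slopeAt p ω b * b ^ 2 / 2 := by
  have hN := expo_pos hp
  have hp0 : 0 < p := by linarith
  have hcs := continuous_slopeAt hp ω
  have hc : Continuous fun s => s * slopeAt p ω s := continuous_id.mul hcs
  have hcp := continuous_posPow (ω := ω) hN.le
  have hJ : ∀ x, HasDerivAt (fun x => ∫ y in (0 : ℝ)..x, posPow (expo p) ω y)
      (posPow (expo p) ω x) x := fun x =>
    intervalIntegral.integral_hasDerivAt_right (hcp.intervalIntegrable _ _)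
      (hcp.stronglyMeasurableAtFilter _ _) hcp.continuousAt
  let Ψ : ℝ → ℝ := fun v => slopeAt p ω v * v ^ 2 / 2
    - coef p / 2 * (∫ y in (0 : ℝ)..slopeAt p ω v, posPow (expo p) ω y)
  have hΨc : Continuous Ψ := by
    have h1 : Continuous fun x => ∫ y in (0 : ℝ)..x, posPow (expo p) ω y :=
      continuous_iff_continuousAt.2 fun x => (hJ x).continuousAt
    exact ((hcs.mul (continuous_pow 2)).div_const 2).sub (continuous_const.mul (h1.comp hcs))
  have hd : ∀ v ∈ Ioo b (amplitude p ω), HasDerivAt Ψ (v * slopeAt p ω v) v := by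
    intro v hv
    have hv0 : 0 < v := hb.trans_lt hv.1
    have hlt := two_div_mul_rpow_lt hp hω hv0.le hv.2
    obtain ⟨d, hX⟩ : ∃ d, HasDerivAt (slopeAt p ω) d v :=
      ⟨_, (((Real.hasDerivAt_rpow_const (p := p - 2) (Or.inl hv0.ne')).const_mul (2 / p)).const_sub
        ω).sqrt (by linarith)⟩
    have hsq := slopeAt_sq hp hω hv0.le hv.2.le
    have hle : slopeAt p ω v ^ 2 ≤ ω := by
      rw [hsq]
      have : 0 ≤ 2 / p * v ^ (p - 2) := by positivity
      linarith
    have e : coef p * posPow (expo p) ω (slopeAt p ω v) = v ^ 2 := by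
      rw [posPow_of_sq_le hle, ← sq_eq_coef_mul_rpow hp hv0.le hsq]
    have h := ((hX.mul (hasDerivAt_pow 2 v)).div_const 2).sub
      (((hJ _).comp v hX).const_mul (coef p / 2))
    refine h.congr_deriv ?_
    rw [show coef p / 2 * (posPow (expo p) ω (slopeAt p ω v) * d)
      = (coef p * posPow (expo p) ω (slopeAt p ω v)) * d / 2 by ring, e]
    simp only [Nat.cast_ofNat, Nat.add_one_sub_one, pow_one]
    ring
  have h1 := intervalIntegral.integral_eq_sub_of_hasDerivAt_of_le hba hΨc.continuousOn hd
    (hc.intervalIntegrable _ _)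
  have h3 : Ψ (amplitude p ω) = 0 := by simp [Ψ, slopeAt_amplitude hp hω]
  rw [potential, potential, intervalIntegral.integral_interval_sub_left
    (hc.intervalIntegrable _ _) (hc.intervalIntegrable _ _), h1, h3]
  simp only [Ψ]
  ring

lemma solitonSlope_sq_lt (hω : 0 < ω) (x : ℝ) : solitonSlope p ω x ^ 2 < ω := by
  rw [solitonSlope, mul_pow, Real.sq_sqrt hω.le]
  exact mul_lt_of_lt_one_right hω (Real.tanh_sq_lt_one _)

lemma soliton_eq (p : ℝ) (hω : 0 < ω) (x : ℝ) :
    soliton p ω x = (p / 2 * (ω - solitonSlope p ω x ^ 2)) ^ (1 / (p - 2)) := by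
  have h : Real.cosh ((p / 2 - 1) * √ω * |x|) = Real.cosh ((p / 2 - 1) * √ω * x) := by
    rcases abs_choice x with h | h <;> rw [h]
    rw [mul_neg, Real.cosh_neg]
  rw [soliton, h, inv_cosh_sq, solitonSlope, mul_pow, Real.sq_sqrt hω.le]
  ring_nf

lemma soliton_base_pos (hp : 2 < p) (hω : 0 < ω) (x : ℝ) :
    0 < p / 2 * (ω - solitonSlope p ω x ^ 2) :=
  mul_pos (by linarith) (by linarith [solitonSlope_sq_lt (p := p) hω x])

lemma soliton_pos (hp : 2 < p) (hω : 0 < ω) (x : ℝ) : 0 < soliton p ω x := by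
  rw [soliton_eq p hω]; exact Real.rpow_pos_of_pos (soliton_base_pos hp hω x) _

lemma soliton_rpow (hp : 2 < p) (hω : 0 < ω) (x : ℝ) :
    soliton p ω x ^ (p - 2) = p / 2 * (ω - solitonSlope p ω x ^ 2) := by
  rw [soliton_eq p hω, ← Real.rpow_mul (soliton_base_pos hp hω x).le,
    one_div_mul_cancel (by linarith), Real.rpow_one]

lemma eq_soliton_of_rpow (hp : 2 < p) (hω : 0 < ω) {v x : ℝ} (hv : 0 ≤ v)
    (h : v ^ (p - 2) = p / 2 * (ω - solitonSlope p ω x ^ 2)) : v = soliton p ω x := by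
  rw [soliton_eq p hω, ← h, ← Real.rpow_mul hv, mul_one_div_cancel (by linarith), Real.rpow_one]

lemma soliton_le_amplitude (hp : 2 < p) (hω : 0 < ω) (x : ℝ) :
    soliton p ω x ≤ amplitude p ω := by
  rw [soliton_eq p hω, amplitude]
  refine Real.rpow_le_rpow (soliton_base_pos hp hω x).le ?_ (one_div_nonneg.2 (by linarith))
  have : 0 < p := by linarith
  gcongr
  linarith [sq_nonneg (solitonSlope p ω x)]

lemma soliton_sq (hp : 2 < p) (hω : 0 < ω) (x : ℝ) :
    soliton p ω x ^ 2 = coef p * (ω - solitonSlope p ω x ^ 2) ^ expo p := by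
  refine sq_eq_coef_mul_rpow hp (soliton_pos hp hω x).le ?_
  rw [soliton_rpow hp hω]
  have : 0 < p := by linarith
  field_simp
  ring

lemma soliton_rpow_self (hp : 2 < p) (hω : 0 < ω) (x : ℝ) :
    soliton p ω x ^ p = p / 2 * (ω - solitonSlope p ω x ^ 2) * soliton p ω x ^ 2 := by
  rw [← soliton_rpow hp hω, ← Real.rpow_natCast, ← Real.rpow_add (soliton_pos hp hω x)]
  norm_num

lemma slopeAt_soliton (hp : 2 < p) (hω : 0 < ω) (x : ℝ) :
    slopeAt p ω (soliton p ω x) = |solitonSlope p ω x| := by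
  rw [slopeAt, soliton_rpow hp hω, ← Real.sqrt_sq_eq_abs]
  have : 0 < p := by linarith
  congr 1
  field_simp
  ring

lemma hasDerivAt_solitonSlope (hp : 2 < p) (hω : 0 < ω) (x : ℝ) :
    HasDerivAt (solitonSlope p ω) ((ω - solitonSlope p ω x ^ 2) / expo p) x := by
  have h1 : HasDerivAt (fun x => (p / 2 - 1) * √ω * x) ((p / 2 - 1) * √ω) x := by
    simpa using (hasDerivAt_id x).const_mul ((p / 2 - 1) * √ω)
  have h2 := ((hasDerivAt_tanh ((p / 2 - 1) * √ω * x)).comp x h1).const_mul √ω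
  refine h2.congr_deriv ?_
  rw [eq_div_iff (expo_pos hp).ne', solitonSlope, mul_pow, Real.sq_sqrt hω.le]
  have hr := rate_mul_expo hp ω
  have hs := Real.mul_self_sqrt hω.le
  linear_combination (√ω * (1 - Real.tanh ((p / 2 - 1) * √ω * x) ^ 2)) * hr
    + (1 - Real.tanh ((p / 2 - 1) * √ω * x) ^ 2) * hs

lemma continuous_solitonSlope (hp : 2 < p) (hω : 0 < ω) : Continuous (solitonSlope p ω) :=
  continuous_iff_continuousAt.2 fun x => (hasDerivAt_solitonSlope hp hω x).continuousAt

lemma hasDerivAt_soliton (hp : 2 < p) (hω : 0 < ω) (x : ℝ) :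
    HasDerivAt (soliton p ω) (-(solitonSlope p ω x) * soliton p ω x) x := by
  have h1 := ((((hasDerivAt_solitonSlope hp hω x).pow 2).const_sub ω).const_mul (p / 2)).rpow_const
    (p := 1 / (p - 2)) (Or.inl (soliton_base_pos hp hω x).ne')
  have e : (fun x => (p / 2 * (ω - solitonSlope p ω x ^ 2)) ^ (1 / (p - 2))) = soliton p ω :=
    funext fun x => (soliton_eq p hω x).symm
  have h2 := h1.congr_deriv (g' := -(solitonSlope p ω x) * soliton p ω x) ?_
  · exact e ▸ h2
  have hb := soliton_base_pos hp hω x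
  simp only [Pi.pow_apply]
  rw [Real.rpow_sub_one hb.ne', ← soliton_eq p hω]
  have h3 : ω - solitonSlope p ω x ^ 2 ≠ 0 := by
    intro h; rw [h, mul_zero] at hb; exact lt_irrefl _ hb
  have h4 : p - 2 ≠ 0 := by linarith
  have h5 : p ≠ 0 := by linarith
  rw [expo]
  field_simp
  simp

lemma continuous_soliton (hp : 2 < p) (hω : 0 < ω) : Continuous (soliton p ω) :=
  continuous_iff_continuousAt.2 fun x => (hasDerivAt_soliton hp hω x).continuousAt

lemma solitonSlope_neg (p ω x : ℝ) : solitonSlope p ω (-x) = -solitonSlope p ω x := by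
  rw [solitonSlope, mul_neg, Real.tanh_neg, solitonSlope, mul_neg]

lemma soliton_neg (p ω x : ℝ) : soliton p ω (-x) = soliton p ω x := by
  rw [soliton, soliton, abs_neg]

lemma solitonSlope_strictMono (hp : 2 < p) (hω : 0 < ω) : StrictMono (solitonSlope p ω) := by
  intro x y hxy
  have h1 : 0 < p / 2 - 1 := by linarith
  have h2 := Real.sqrt_pos.2 hω
  exact mul_lt_mul_of_pos_left (tanh_strictMono (by gcongr)) h2

lemma solitonSlope_zero (p ω : ℝ) : solitonSlope p ω 0 = 0 := by simp [solitonSlope]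

lemma tendsto_solitonSlope (hp : 2 < p) (hω : 0 < ω) :
    Tendsto (solitonSlope p ω) atTop (𝓝 √ω) := by
  have h1 : 0 < (p / 2 - 1) * √ω := mul_pos (by linarith) (Real.sqrt_pos.2 hω)
  have := (tendsto_tanh_atTop.comp (tendsto_id.const_mul_atTop h1)).const_mul √ω
  rwa [mul_one] at this

/-- The soliton decreases away from the origin. -/
lemma soliton_le_soliton (hp : 2 < p) (hω : 0 < ω) {x y : ℝ} (hx : 0 ≤ x) (hxy : x ≤ y) :
    soliton p ω y ≤ soliton p ω x := by
  rw [soliton_eq p hω, soliton_eq p hω]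
  refine Real.rpow_le_rpow (soliton_base_pos hp hω y).le ?_ (one_div_nonneg.2 (by linarith))
  have h0 : 0 ≤ solitonSlope p ω x := by
    rw [← solitonSlope_zero p ω]; exact (solitonSlope_strictMono hp hω).monotone hx
  have h1 := (solitonSlope_strictMono hp hω).monotone hxy
  have : 0 < p := by linarith
  gcongr

/-- Any admissible slope is attained by the soliton. -/
lemma exists_solitonSlope_eq (hp : 2 < p) (hω : 0 < ω) {y : ℝ} (hy : y ^ 2 < ω) :
    ∃ x, solitonSlope p ω x = y := by
  have h1 : 0 < p / 2 - 1 := by linarith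
  have h2 := Real.sqrt_pos.2 hω
  have h3 : |y| < √ω := by rw [← Real.sqrt_sq_eq_abs]; exact Real.sqrt_lt_sqrt (sq_nonneg _) hy
  have h4 := abs_lt.1 h3
  refine ⟨Real.artanh (y / √ω) / ((p / 2 - 1) * √ω), ?_⟩
  rw [solitonSlope, mul_div_cancel₀ _ (by positivity), Real.tanh_artanh, mul_div_cancel₀ _ h2.ne']
  exact ⟨by rw [lt_div_iff₀ h2]; linarith, by rw [div_lt_iff₀ h2]; linarith⟩

end Soliton

/-! ### Mass and kinetic energy of truncated solitons -/

section SolitonIntegrals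

variable {p ω : ℝ}

lemma hasDerivAt_sub_const_comp {f : ℝ → ℝ} {f' a x : ℝ} (h : HasDerivAt f f' (x - a)) :
    HasDerivAt (fun x => f (x - a)) f' x :=
  (h.comp x ((hasDerivAt_id x).sub_const a)).congr_deriv (mul_one _)

lemma tendsto_sub_const_atTop (a : ℝ) : Tendsto (fun x : ℝ => x - a) atTop atTop :=
  tendsto_atTop_add_const_right _ (-a) tendsto_id

lemma hasDerivAt_integral_rpow {s : ℝ} (hs : 0 ≤ s) (ω x : ℝ) :
    HasDerivAt (fun x => ∫ y in (0 : ℝ)..x, (ω - y ^ 2) ^ s) ((ω - x ^ 2) ^ s) x := by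
  have hc : Continuous fun y : ℝ => (ω - y ^ 2) ^ s :=
    (by fun_prop : Continuous fun y : ℝ => ω - y ^ 2).rpow_const fun _ => Or.inr hs
  exact intervalIntegral.integral_hasDerivAt_right (hc.intervalIntegrable _ _)
    (hc.stronglyMeasurableAtFilter _ _) hc.continuousAt

lemma intervalIntegrable_rpow {s : ℝ} (hs : 0 ≤ s) (ω a b : ℝ) :
    IntervalIntegrable (fun y : ℝ => (ω - y ^ 2) ^ s) volume a b :=
  ((by fun_prop : Continuous fun y : ℝ => ω - y ^ 2).rpow_const
    fun _ => Or.inr hs).intervalIntegrable _ _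

/-- The mass of a truncated soliton, with the slope as variable of integration. -/
lemma soliton_mass (hp : 2 < p) (hp4 : p ≤ 4) (hω : 0 < ω) (a : ℝ) :
    IntegrableOn (fun x => soliton p ω (x - a) ^ 2) (Ioi 0) ∧
    ∫ x in Ioi 0, soliton p ω (x - a) ^ 2
      = coef p * (expo p * ∫ y in (-solitonSlope p ω a)..√ω, (ω - y ^ 2) ^ (expo p - 1)) := by
  have hN := one_le_expo hp hp4
  have hN0 := expo_pos hp
  let P : ℝ → ℝ := fun x => ∫ y in (0 : ℝ)..x, (ω - y ^ 2) ^ (expo p - 1)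
  have hP : ∀ x, HasDerivAt P ((ω - x ^ 2) ^ (expo p - 1)) x :=
    hasDerivAt_integral_rpow (by linarith) ω
  have hd : ∀ x ∈ Ici (0 : ℝ), HasDerivAt
      (fun x => coef p * (expo p * P (solitonSlope p ω (x - a)))) (soliton p ω (x - a) ^ 2) x := by
    intro x _
    have h := (((hP _).comp x (hasDerivAt_sub_const_comp
      (hasDerivAt_solitonSlope hp hω (x - a)))).const_mul (expo p)).const_mul (coef p)
    refine h.congr_deriv ?_
    have hb : 0 < ω - solitonSlope p ω (x - a) ^ 2 := by
      linarith [solitonSlope_sq_lt (p := p) hω (x - a)]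
    rw [soliton_sq hp hω, Real.rpow_sub_one hb.ne']
    field_simp
  have ht : Tendsto (fun x => coef p * (expo p * P (solitonSlope p ω (x - a)))) atTop
      (𝓝 (coef p * (expo p * P √ω))) :=
    (((hP √ω).continuousAt.tendsto.comp ((tendsto_solitonSlope hp hω).comp
      (tendsto_sub_const_atTop a))).const_mul _).const_mul _
  refine ⟨integrableOn_Ioi_deriv_of_nonneg' hd (fun x _ => sq_nonneg _) ht, ?_⟩
  rw [integral_Ioi_of_hasDerivAt_of_nonneg' hd (fun x _ => sq_nonneg _) ht, zero_sub,
    solitonSlope_neg, ← mul_sub, ← mul_sub]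
  simp only [P]
  rw [intervalIntegral.integral_interval_sub_left] <;>
    exact intervalIntegrable_rpow (by linarith) _ _ _

/-- The kinetic energy of a truncated soliton, with the slope as variable of integration. -/
lemma soliton_kinetic (hp : 2 < p) (hω : 0 < ω) (a : ℝ) :
    IntegrableOn (fun x => (-solitonSlope p ω (x - a) * soliton p ω (x - a)) ^ 2) (Ioi 0) ∧
    ∫ x in Ioi 0, (-solitonSlope p ω (x - a) * soliton p ω (x - a)) ^ 2
      = coef p / 2 * (∫ y in (-solitonSlope p ω a)..√ω, (ω - y ^ 2) ^ expo p)
        - solitonSlope p ω a * soliton p ω a ^ 2 / 2 := by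
  have hN0 := expo_pos hp
  let P : ℝ → ℝ := fun x => ∫ y in (0 : ℝ)..x, (ω - y ^ 2) ^ expo p
  have hP : ∀ x, HasDerivAt P ((ω - x ^ 2) ^ expo p) x := hasDerivAt_integral_rpow hN0.le ω
  have hd : ∀ x ∈ Ici (0 : ℝ), HasDerivAt
      (fun x => coef p / 2 * P (solitonSlope p ω (x - a))
        - solitonSlope p ω (x - a) * soliton p ω (x - a) ^ 2 / 2)
      ((-solitonSlope p ω (x - a) * soliton p ω (x - a)) ^ 2) x := by
    intro x _
    have hY := hasDerivAt_sub_const_comp (hasDerivAt_solitonSlope hp hω (x - a))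
    have hη := hasDerivAt_sub_const_comp (hasDerivAt_soliton hp hω (x - a))
    have h := (((hP _).comp x hY).const_mul (coef p / 2)).sub ((hY.mul (hη.pow 2)).div_const 2)
    refine h.congr_deriv ?_
    have e := soliton_sq hp hω (x - a)
    rw [show coef p / 2 * ((ω - solitonSlope p ω (x - a) ^ 2) ^ expo p
      * ((ω - solitonSlope p ω (x - a) ^ 2) / expo p)) =
      (coef p * (ω - solitonSlope p ω (x - a) ^ 2) ^ expo p)
      * ((ω - solitonSlope p ω (x - a) ^ 2) / expo p) / 2 by ring, ← e]
    simp only [Pi.pow_apply, Nat.cast_ofNat, Nat.add_one_sub_one, pow_one]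
    ring
  have hYt := (tendsto_solitonSlope hp hω).comp (tendsto_sub_const_atTop a)
  have hηt : Tendsto (fun x => soliton p ω (x - a) ^ 2) atTop (𝓝 0) := by
    simp only [soliton_sq hp hω]
    have h1 : Tendsto (fun x => ω - solitonSlope p ω (x - a) ^ 2) atTop (𝓝 0) := by
      have := (hYt.pow 2).const_sub ω
      rwa [Real.sq_sqrt hω.le, sub_self] at this
    have h2 := (h1.rpow_const (p := expo p) (Or.inr hN0.le)).const_mul (coef p)
    rwa [Real.zero_rpow hN0.ne', mul_zero] at h2
  have ht : Tendsto (fun x => coef p / 2 * P (solitonSlope p ω (x - a))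
        - solitonSlope p ω (x - a) * soliton p ω (x - a) ^ 2 / 2) atTop
      (𝓝 (coef p / 2 * P √ω)) := by
    have h1 := ((hP √ω).continuousAt.tendsto.comp hYt).const_mul (coef p / 2)
    have h2 := (hYt.mul hηt).div_const 2
    simpa using h1.sub h2
  refine ⟨integrableOn_Ioi_deriv_of_nonneg' hd (fun x _ => sq_nonneg _) ht, ?_⟩
  rw [integral_Ioi_of_hasDerivAt_of_nonneg' hd (fun x _ => sq_nonneg _) ht, zero_sub,
    solitonSlope_neg, soliton_neg, ← intervalIntegral.integral_interval_sub_left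
      (intervalIntegrable_rpow hN0.le ω 0 √ω) (intervalIntegrable_rpow hN0.le ω 0 _)]
  simp only [P]
  ring

/-- Rescaling the slope by `√ω`. -/
lemma integral_rpow_scale (hω : 0 < ω) (s : ℝ) {τ : ℝ} (hτ : |τ| ≤ 1) :
    ∫ y in (-(√ω * τ))..√ω, (ω - y ^ 2) ^ s
      = ω ^ (s + 1 / 2) * ∫ q in (-τ)..1, (1 - q ^ 2) ^ s := by
  have h0 := Real.sqrt_pos.2 hω
  have h := intervalIntegral.smul_integral_comp_mul_left (E := ℝ) (a := -τ) (b := 1)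
    (fun y : ℝ => (ω - y ^ 2) ^ s) √ω
  rw [mul_one, mul_neg] at h
  rw [← h, smul_eq_mul, Real.rpow_add hω, ← Real.sqrt_eq_rpow, mul_comm (ω ^ s), mul_assoc]
  congr 1
  rw [← intervalIntegral.integral_const_mul]
  refine intervalIntegral.integral_congr (E := ℝ) fun q hq => ?_
  have hτ' := abs_le.1 hτ
  rw [uIcc_of_le (by linarith)] at hq
  have : 0 ≤ 1 - q ^ 2 := by nlinarith [hq.1, hq.2]
  rw [← Real.mul_rpow hω.le this, mul_pow, Real.sq_sqrt hω.le]
  ring_nf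

end SolitonIntegrals

/-! ### The lower bound for the energy -/

section LowerBound

variable {p α ω : ℝ} {w γ : ℝ → ℝ}

/-- The energy in terms of the moduli `w` of the function and `γ` of its derivative. -/
noncomputable def profileEnergy (p α : ℝ) (w γ : ℝ → ℝ) : ℝ :=
  1 / 2 * (∫ x in Ioi 0, γ x ^ 2) - 1 / p * (∫ x in Ioi 0, w x ^ p) + α / 2 * w 0 ^ 2

/-- The frequency of the soliton with maximum `m`. -/
noncomputable def freqOf (p m : ℝ) : ℝ := 2 / p * m ^ (p - 2)

lemma freqOf_pos (hp : 2 < p) {m : ℝ} (hm : 0 < m) : 0 < freqOf p m :=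
  mul_pos (div_pos two_pos (by linarith)) (Real.rpow_pos_of_pos hm _)

lemma amplitude_freqOf (hp : 2 < p) {m : ℝ} (hm : 0 < m) : amplitude p (freqOf p m) = m := by
  have : 0 < p := by linarith
  rw [amplitude, freqOf, show p / 2 * (2 / p * m ^ (p - 2)) = m ^ (p - 2) by field_simp,
    ← Real.rpow_mul hm.le, mul_one_div_cancel (by linarith), Real.rpow_one]

lemma IsProfile.grad_slope_integrable (h : IsProfile w γ) (hp : 2 < p) (ω : ℝ) :
    IntegrableOn (fun t => w t * slopeAt p ω (w t) * γ t) (Ioi 0) := by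
  have hm : AEStronglyMeasurable (fun t => slopeAt p ω (w t)) halfLine :=
    (continuous_slopeAt hp ω).comp_aestronglyMeasurable h.memLp.1
  refine Integrable.mono' (h.integrable_mul.const_mul √ω)
    ((h.memLp.1.mul hm).mul h.grad_memLp.1) (ae_of_all _ fun t => ?_)
  have h1 := h.nonneg t
  have h2 := h.grad_nonneg t
  have h3 : 0 ≤ slopeAt p ω (w t) := Real.sqrt_nonneg _
  rw [Real.norm_of_nonneg (by positivity)]
  calc w t * slopeAt p ω (w t) * γ t ≤ w t * √ω * γ t := by gcongr; exact slopeAt_le hp h1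
    _ = √ω * (w t * γ t) := by ring

/-- Rising from the boundary value to the maximum and decaying to zero costs twice the potential of
the maximum, minus the potential of the boundary value. -/
lemma IsProfile.potential_le_integral (h : IsProfile w γ) (hp : 2 < p) (ω : ℝ) {x₀ : ℝ}
    (hx₀ : 0 ≤ x₀) :
    2 * potential p ω (w x₀) - potential p ω (w 0)
      ≤ ∫ t in Ioi 0, w t * slopeAt p ω (w t) * γ t := by
  have hG := h.grad_slope_integrable hp ω
  have hchain : ∀ a b, 0 ≤ a → a ≤ b → |potential p ω (w b) - potential p ω (w a)|
      ≤ ∫ t in a..b, w t * slopeAt p ω (w t) * γ t := by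
    intro a b ha hab
    refine (h.abs_comp_sub_le ha hab (hasDerivAt_potential hp)
      (continuous_id.mul (continuous_slopeAt hp ω))).trans (le_of_eq ?_)
    refine intervalIntegral.integral_congr fun t _ => ?_
    have h0 : 0 ≤ w t * slopeAt p ω (w t) := mul_nonneg (h.nonneg t) (Real.sqrt_nonneg _)
    rw [abs_of_nonneg h0]
  have h1 : potential p ω (w x₀) - potential p ω (w 0)
      ≤ ∫ t in Ioc 0 x₀, w t * slopeAt p ω (w t) * γ t := by
    rw [← intervalIntegral.integral_of_le hx₀]
    exact (le_abs_self _).trans (hchain 0 x₀ le_rfl hx₀)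
  have h2 : potential p ω (w x₀) ≤ ∫ t in Ioi x₀, w t * slopeAt p ω (w t) * γ t := by
    have hlim : Tendsto (fun X => potential p ω (w x₀) - potential p ω (w X)) atTop
        (𝓝 (potential p ω (w x₀) - potential p ω 0)) :=
      ((hasDerivAt_potential hp 0).continuousAt.tendsto.comp h.tendsto_zero).const_sub _
    have h0 : potential p ω 0 = 0 := by simp [potential]
    rw [h0, sub_zero] at hlim
    refine le_of_tendsto hlim ?_
    filter_upwards [eventually_ge_atTop x₀] with X hX
    have hsub : Ioi x₀ ⊆ Ioi 0 := Ioi_subset_Ioi hx₀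
    calc _ ≤ |potential p ω (w X) - potential p ω (w x₀)| := by
          rw [abs_sub_comm]; exact le_abs_self _
      _ ≤ ∫ t in Ioc x₀ X, w t * slopeAt p ω (w t) * γ t := by
          rw [← intervalIntegral.integral_of_le hX]; exact hchain x₀ X hx₀ hX
      _ ≤ _ := setIntegral_mono_set (hG.mono_set hsub) (ae_of_all _ fun t =>
          mul_nonneg (mul_nonneg (h.nonneg t) (Real.sqrt_nonneg _)) (h.grad_nonneg t))
          Ioc_subset_Ioi_self.eventuallyLE
  rw [← Ioc_union_Ioi_eq_Ioi hx₀, setIntegral_union (Ioc_disjoint_Ioi le_rfl) measurableSet_Ioi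
    (hG.mono_set Ioc_subset_Ioi_self) (hG.mono_set (Ioi_subset_Ioi hx₀))]
  linarith

/-- Completing the square in the energy, at the frequency of the soliton with the same maximum. -/
lemma IsProfile.profileEnergy_eq (h : IsProfile w γ) (hp : 2 < p) (hω : 0 < ω)
    (hmax : ∀ x, 0 ≤ x → w x ≤ amplitude p ω) :
    IntegrableOn (fun t => (γ t - w t * slopeAt p ω (w t)) ^ 2) (Ioi 0) ∧
    profileEnergy p α w γ + ω / 2 * ∫ x in Ioi 0, w x ^ 2
      = 1 / 2 * (∫ t in Ioi 0, (γ t - w t * slopeAt p ω (w t)) ^ 2)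
        + (∫ t in Ioi 0, w t * slopeAt p ω (w t) * γ t) + α / 2 * w 0 ^ 2 := by
  have hG := h.grad_slope_integrable hp ω
  have hγ : IntegrableOn (fun t => γ t ^ 2) (Ioi 0) := h.grad_memLp.integrable_sq
  have hw := h.integrable_sq
  have hwp := h.rpow_integrable hp
  have hp0 : 0 < p := by linarith
  have e : ∀ t ∈ Ioi (0 : ℝ), (γ t - w t * slopeAt p ω (w t)) ^ 2
      = γ t ^ 2 - 2 * (w t * slopeAt p ω (w t) * γ t) + (ω * w t ^ 2 - 2 / p * w t ^ p) := by
    intro t ht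
    have h0 : (0 : ℝ) ≤ t := le_of_lt ht
    have hs := slopeAt_sq hp hω (h.nonneg t) (hmax t h0)
    have hpw : w t ^ p = w t ^ (p - 2) * w t ^ 2 := by
      rcases (h.nonneg t).eq_or_lt with hw0 | hw0
      · rw [← hw0, Real.zero_rpow hp0.ne']; simp
      · rw [← Real.rpow_natCast, ← Real.rpow_add hw0]; norm_num
    rw [hpw]
    linear_combination w t ^ 2 * hs
  have i1 : IntegrableOn (fun t => γ t ^ 2 - 2 * (w t * slopeAt p ω (w t) * γ t)) (Ioi 0) :=
    hγ.sub (hG.const_mul 2)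
  have i2 : IntegrableOn (fun t => ω * w t ^ 2 - 2 / p * w t ^ p) (Ioi 0) :=
    (hw.const_mul ω).sub (hwp.const_mul (2 / p))
  have hI : IntegrableOn (fun t => γ t ^ 2 - 2 * (w t * slopeAt p ω (w t) * γ t)
      + (ω * w t ^ 2 - 2 / p * w t ^ p)) (Ioi 0) := i1.add i2
  refine ⟨hI.congr_fun (fun t ht => (e t ht).symm) measurableSet_Ioi, ?_⟩
  rw [setIntegral_congr_fun measurableSet_Ioi e, integral_add i1 i2,
    integral_sub hγ (hG.const_mul 2),
    integral_sub (hw.const_mul ω) (hwp.const_mul (2 / p)), integral_const_mul, integral_const_mul,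
    integral_const_mul, profileEnergy]
  field_simp
  ring

/-- The energy is bounded below by the Legendre-type expression `S(ω) - ω μ / 2`, at the frequency
`ω` of the soliton with the same maximum; equality forces the profile to follow the soliton flow and
fixes the boundary value. -/
lemma IsProfile.action_le_profileEnergy (h : IsProfile w γ) (hp : 2 < p) (hα : 0 < α) {x₀ : ℝ}
    (hx₀ : 0 ≤ x₀) (hw₀ : 0 < w x₀) (hmax : ∀ x, 0 ≤ x → w x ≤ w x₀) :
    coef p / 2 * action α (expo p) (freqOf p (w x₀)) - freqOf p (w x₀) / 2 * (∫ x in Ioi 0, w x ^ 2)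
      ≤ profileEnergy p α w γ ∧
    (profileEnergy p α w γ ≤ coef p / 2 * action α (expo p) (freqOf p (w x₀))
        - freqOf p (w x₀) / 2 * (∫ x in Ioi 0, w x ^ 2) →
      (∀ᵐ t ∂halfLine, γ t = w t * slopeAt p (freqOf p (w x₀)) (w t)) ∧
      slopeAt p (freqOf p (w x₀)) (w 0) = min α √(freqOf p (w x₀))) := by
  set ω := freqOf p (w x₀) with hω_def
  have hω : 0 < ω := freqOf_pos hp hw₀
  have hA : amplitude p ω = w x₀ := amplitude_freqOf hp hw₀
  have hN := expo_pos hp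
  have hK := coef_pos hp
  obtain ⟨hI, hE⟩ := h.profileEnergy_eq (α := α) hp hω (fun x hx => hA ▸ hmax x hx)
  have hP := h.potential_le_integral hp ω hx₀
  have hsq0 : 0 ≤ ∫ t in Ioi 0, (γ t - w t * slopeAt p ω (w t)) ^ 2 :=
    integral_nonneg fun t => sq_nonneg _
  have hb := h.nonneg 0
  have hba : w 0 ≤ amplitude p ω := hA ▸ hmax 0 le_rfl
  have e1 := potential_amplitude_sub hp hω hb hba
  have e2 := potential_amplitude_sub hp hω le_rfl (amplitude_pos hp hω).le
  rw [slopeAt_zero hp, show potential p ω 0 = 0 by simp [potential]] at e2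
  rw [hA] at e1 e2
  have hs := slopeAt_sq hp hω hb hba
  have hle : slopeAt p ω (w 0) ^ 2 ≤ ω := by
    have : 0 ≤ 2 / p * w 0 ^ (p - 2) := mul_nonneg (div_nonneg two_pos.le (by linarith))
      (Real.rpow_nonneg hb _)
    linarith
  have e3 : w 0 ^ 2 = coef p * posPow (expo p) ω (slopeAt p ω (w 0)) := by
    rw [posPow_of_sq_le hle]; exact sq_eq_coef_mul_rpow hp hb hs
  obtain ⟨b1, b2⟩ := integral_posPow_le_boundary (ω := ω) (x := slopeAt p ω (w 0)) hN hα
    (Real.sqrt_nonneg _) (slopeAt_le (ω := ω) hp hb)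
  have e4 := action_eq_add (α := α) (ω := ω) hN.le
  rw [e3] at e1 hE
  rw [e4]
  constructor
  · linarith [mul_le_mul_of_nonneg_left b1 hK.le]
  · intro hle'
    have hx : slopeAt p ω (w 0) = min α √ω := by
      by_contra hne
      linarith [mul_lt_mul_of_pos_left (b2 hne) hK]
    refine ⟨?_, hx⟩
    have hz : ∫ t in Ioi 0, (γ t - w t * slopeAt p ω (w t)) ^ 2 = 0 := by
      linarith [mul_le_mul_of_nonneg_left b1 hK.le]
    rw [integral_eq_zero_iff_of_nonneg (fun t => sq_nonneg _) hI] at hz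
    filter_upwards [hz] with t ht
    have : γ t - w t * slopeAt p ω (w t) = 0 := by simpa using ht
    linarith

end LowerBound

/-! ### Comparison with the soliton -/

section Comparison

variable {p α ω : ℝ} {w γ : ℝ → ℝ}

/-- A continuous function passing from below `c` to above `d` has a crossing of the strip
`[c, d]`. -/
lemma exists_crossing {f : ℝ → ℝ} {a b c d : ℝ} (hab : a ≤ b) (hf : ContinuousOn f (Icc a b))
    (hcd : c < d) (ha : f a ≤ c) (hb : d ≤ f b) :
    ∃ s t, a ≤ s ∧ s ≤ t ∧ t ≤ b ∧ f s = c ∧ f t = d ∧ ∀ x ∈ Icc s t, f x ∈ Icc c d := by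
  have hT : IsCompact (Icc a b ∩ f ⁻¹' Ici d) :=
    isCompact_Icc.of_isClosed_subset (hf.preimage_isClosed_of_isClosed isClosed_Icc isClosed_Ici)
      inter_subset_left
  obtain ⟨t, ht, htl⟩ := hT.exists_isLeast ⟨b, ⟨hab, le_rfl⟩, hb⟩
  have hft : f t = d := by
    obtain ⟨x, hx, hxd⟩ := intermediate_value_Icc ht.1.1
      (hf.mono (Icc_subset_Icc_right ht.1.2)) ⟨ha.trans hcd.le, ht.2⟩
    have : t ≤ x := htl ⟨⟨hx.1, hx.2.trans ht.1.2⟩, hxd.ge⟩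
    rw [← hxd, le_antisymm this hx.2]
  have hf' : ContinuousOn f (Icc a t) := hf.mono (Icc_subset_Icc_right ht.1.2)
  have hS : IsCompact (Icc a t ∩ f ⁻¹' Iic c) :=
    isCompact_Icc.of_isClosed_subset (hf'.preimage_isClosed_of_isClosed isClosed_Icc isClosed_Iic)
      inter_subset_left
  obtain ⟨s, hs, hsg⟩ := hS.exists_isGreatest ⟨a, ⟨le_rfl, ht.1.1⟩, ha⟩
  have hfs : f s = c := by
    obtain ⟨x, hx, hxc⟩ := intermediate_value_Icc hs.1.2
      (hf'.mono (Icc_subset_Icc_left hs.1.1)) ⟨hs.2, hft ▸ hcd.le⟩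
    have : x ≤ s := hsg ⟨⟨hs.1.1.trans hx.1, hx.2⟩, hxc.le⟩
    rw [← hxc, le_antisymm this hx.1]
  refine ⟨s, t, hs.1.1, hs.1.2, ht.1.2, hfs, hft, fun x hx => ⟨?_, ?_⟩⟩
  · by_contra! hlt
    have : x ≤ s := hsg ⟨⟨hs.1.1.trans hx.1, hx.2⟩, hlt.le⟩
    rw [le_antisymm this hx.1, hfs] at hlt
    exact lt_irrefl _ hlt
  · by_contra! hlt
    have : t ≤ x := htl ⟨⟨hs.1.1.trans hx.1, hx.2.trans ht.1.2⟩, hlt.le⟩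
    rw [le_antisymm hx.2 this, hft] at hlt
    exact lt_irrefl _ hlt

/-- The position `x ≥ 0` at which the soliton has height `v`. -/
noncomputable def solitonPos (p ω v : ℝ) : ℝ :=
  Real.artanh (slopeAt p ω v / √ω) / ((p / 2 - 1) * √ω)

lemma slopeAt_div_mem (hp : 2 < p) (hω : 0 < ω) {v : ℝ} (hv : 0 < v) (hva : v ≤ amplitude p ω) :
    slopeAt p ω v / √ω ∈ Ico (0 : ℝ) 1 := by
  have h0 := Real.sqrt_pos.2 hω
  refine ⟨div_nonneg (Real.sqrt_nonneg _) h0.le, ?_⟩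
  rw [div_lt_one h0]
  refine Real.sqrt_lt_sqrt (by linarith [two_div_mul_rpow_le hp hω hv.le hva]) ?_
  have : 0 < 2 / p * v ^ (p - 2) := mul_pos (div_pos two_pos (by linarith))
    (Real.rpow_pos_of_pos hv _)
  linarith

lemma solitonPos_nonneg (hp : 2 < p) (hω : 0 < ω) {v : ℝ} (hv : 0 < v)
    (hva : v ≤ amplitude p ω) : 0 ≤ solitonPos p ω v :=
  div_nonneg (Real.artanh_nonneg (slopeAt_div_mem hp hω hv hva).1)
    (mul_nonneg (by linarith) (Real.sqrt_nonneg _))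

lemma solitonSlope_solitonPos (hp : 2 < p) (hω : 0 < ω) {v : ℝ} (hv : 0 < v)
    (hva : v ≤ amplitude p ω) : solitonSlope p ω (solitonPos p ω v) = slopeAt p ω v := by
  have h0 := Real.sqrt_pos.2 hω
  have h1 : 0 < p / 2 - 1 := by linarith
  have h2 := slopeAt_div_mem hp hω hv hva
  rw [solitonSlope, solitonPos, mul_div_cancel₀ _ (by positivity),
    Real.tanh_artanh ⟨by linarith [h2.1], h2.2⟩, mul_div_cancel₀ _ h0.ne']

lemma soliton_solitonPos (hp : 2 < p) (hω : 0 < ω) {v : ℝ} (hv : 0 < v)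
    (hva : v ≤ amplitude p ω) : soliton p ω (solitonPos p ω v) = v := by
  refine (eq_soliton_of_rpow hp hω hv.le ?_).symm
  rw [solitonSlope_solitonPos hp hω hv hva, slopeAt_sq hp hω hv.le hva]
  have : 0 < p := by linarith
  field_simp
  ring

lemma slopeAt_pos (hp : 2 < p) (hω : 0 < ω) {v : ℝ} (hv : 0 ≤ v) (hva : v < amplitude p ω) :
    0 < slopeAt p ω v := by
  exact Real.sqrt_pos.2 (by linarith [two_div_mul_rpow_lt hp hω hv hva])

lemma continuousAt_solitonPos (hp : 2 < p) (hω : 0 < ω) {v : ℝ} (hv : 0 < v)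
    (hva : v ≤ amplitude p ω) : ContinuousAt (solitonPos p ω) v := by
  have h2 := slopeAt_div_mem hp hω hv hva
  have h3 : ContinuousAt Real.artanh (slopeAt p ω v / √ω) :=
    (hasDerivAt_artanh ⟨by linarith [h2.1], h2.2⟩).continuousAt
  have h4 : ContinuousAt (fun v => slopeAt p ω v / √ω) v :=
    (continuous_slopeAt hp ω).continuousAt.div_const _
  exact (ContinuousAt.comp (f := fun v => slopeAt p ω v / √ω) h3 h4).div_const _

lemma hasDerivAt_solitonPos (hp : 2 < p) (hω : 0 < ω) {v : ℝ} (hv : 0 < v)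
    (hva : v < amplitude p ω) :
    HasDerivAt (solitonPos p ω) (-(slopeAt p ω v * v))⁻¹ v := by
  have hd := hasDerivAt_soliton hp hω (solitonPos p ω v)
  rw [solitonSlope_solitonPos hp hω hv hva.le, soliton_solitonPos hp hω hv hva.le, neg_mul] at hd
  refine hd.of_local_left_inverse (continuousAt_solitonPos hp hω hv hva.le) ?_ ?_
  · exact neg_ne_zero.2 (mul_pos (slopeAt_pos hp hω hv.le hva) hv).ne'
  · filter_upwards [Ioo_mem_nhds hv hva] with y hy using soliton_solitonPos hp hω hy.1 hy.2.le

/-- A profile obeying the soliton flow needs at least as much time as the soliton to pass between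
two heights. -/
lemma IsProfile.abs_solitonPos_sub_le (h : IsProfile w γ) (hp : 2 < p) (hω : 0 < ω)
    (hflow : ∀ᵐ t ∂halfLine, γ t = w t * slopeAt p ω (w t)) {s t c d : ℝ} (hs : 0 ≤ s)
    (hst : s ≤ t) (hc : 0 < c) (hd : d < amplitude p ω) (hcd : ∀ x ∈ Icc s t, w x ∈ Icc c d) :
    |solitonPos p ω (w t) - solitonPos p ω (w s)| ≤ t - s := by
  have hcont : ContinuousOn (fun v => (-(slopeAt p ω v * v))⁻¹) (Icc c d) := by
    refine ContinuousOn.inv₀ ((continuous_slopeAt hp ω).mul continuous_id).neg.continuousOn ?_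
    intro v hv
    have hv0 : 0 < v := hc.trans_le hv.1
    exact neg_ne_zero.2 (mul_pos (slopeAt_pos hp hω hv0.le (hv.2.trans_lt hd)) hv0).ne'
  have hw : ContinuousOn w (Icc s t) := h.continuousOn.mono fun x hx => hs.trans hx.1
  refine ((h.isUpperGradient hs hst).abs_comp_sub_le hst hw hcd
    (fun v hv => hasDerivAt_solitonPos hp hω (hc.trans_le hv.1) (hv.2.trans_lt hd)) hcont).trans
    (le_of_eq ?_)
  have hone : ∫ _ in s..t, (1 : ℝ) = t - s := by simp
  rw [← hone]
  refine intervalIntegral.integral_congr_ae ?_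
  rw [ae_restrict_iff' measurableSet_Ioi] at hflow
  filter_upwards [hflow] with x hx hxI
  rw [uIoc_of_le hst] at hxI
  have hm := hcd x (Ioc_subset_Icc_self hxI)
  have hv0 : 0 < w x := hc.trans_le hm.1
  have hpos := mul_pos (slopeAt_pos hp hω hv0.le (hm.2.trans_lt hd)) hv0
  rw [hx (lt_of_le_of_lt hs hxI.1), abs_inv, abs_neg, abs_of_pos hpos, mul_comm (w x),
    inv_mul_cancel₀ hpos.ne']

/-- A profile obeying the soliton flow lies above the soliton centred at its maximum. -/
lemma IsProfile.soliton_le (h : IsProfile w γ) (hp : 2 < p) (hω : 0 < ω)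
    (hflow : ∀ᵐ t ∂halfLine, γ t = w t * slopeAt p ω (w t)) {x₀ x : ℝ} (hx₀ : 0 ≤ x₀)
    (hmax : w x₀ = amplitude p ω) (hx : 0 ≤ x) : soliton p ω (x - x₀) ≤ w x := by
  by_contra! hlt
  obtain ⟨c, hc1, hc2⟩ := exists_between hlt
  have hc0 : 0 < c := (h.nonneg x).trans_lt hc1
  have hcA : c < amplitude p ω := hc2.trans_le (soliton_le_amplitude hp hω _)
  have key : ∀ d ∈ Ioo c (amplitude p ω), solitonPos p ω c - solitonPos p ω d ≤ |x - x₀| := by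
    intro d hd
    rcases le_total x x₀ with hxx | hxx
    · obtain ⟨s, t, h1, h2, h3, h4, h5, h6⟩ := exists_crossing hxx
        (h.continuousOn.mono fun y hy => hx.trans hy.1) hd.1 hc1.le (hmax ▸ hd.2.le)
      have := h.abs_solitonPos_sub_le hp hω hflow (hx.trans h1) h2 hc0 hd.2 h6
      rw [h4, h5, abs_sub_comm] at this
      rw [abs_sub_comm, abs_of_nonneg (by linarith)]
      linarith [le_abs_self (solitonPos p ω c - solitonPos p ω d)]
    · obtain ⟨s, t, h1, h2, h3, h4, h5, h6⟩ := exists_crossing (f := fun y => -w y) (c := -d)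
        (d := -c) hxx (h.continuousOn.mono fun y hy => hx₀.trans hy.1).neg (by linarith [hd.1])
        (by rw [hmax]; linarith [hd.2]) (by linarith)
      have := h.abs_solitonPos_sub_le hp hω hflow (c := c) (d := d) (hx₀.trans h1) h2 hc0 hd.2
        (fun y hy => ⟨by linarith [(h6 y hy).2], by linarith [(h6 y hy).1]⟩)
      rw [neg_inj.1 h4, neg_inj.1 h5] at this
      rw [abs_of_nonneg (by linarith)]
      linarith [le_abs_self (solitonPos p ω c - solitonPos p ω d)]
  have hA := amplitude_pos hp hω
  have hlim : Tendsto (fun d => solitonPos p ω c - solitonPos p ω d) (𝓝[<] amplitude p ω)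
      (𝓝 (solitonPos p ω c - solitonPos p ω (amplitude p ω))) :=
    ((continuousAt_solitonPos hp hω hA le_rfl).tendsto.mono_left nhdsWithin_le_nhds).const_sub _
  have h0 : solitonPos p ω (amplitude p ω) = 0 := by
    rw [solitonPos, slopeAt_amplitude hp hω, zero_div, Real.artanh_zero, zero_div]
  have hle : solitonPos p ω c ≤ |x - x₀| := by
    rw [h0, sub_zero] at hlim
    refine le_of_tendsto hlim ?_
    filter_upwards [Ioo_mem_nhdsLT hcA] with d hd using key d hd
  have := soliton_le_soliton hp hω (solitonPos_nonneg hp hω hc0 hcA.le) hle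
  rw [soliton_solitonPos hp hω hc0 hcA.le] at this
  have e : soliton p ω |x - x₀| = soliton p ω (x - x₀) := by rw [soliton, soliton, abs_abs]
  linarith

/-- Truncating the soliton further to the left increases its mass. -/
lemma soliton_mass_lt (hp : 2 < p) (hp4 : p ≤ 4) (hω : 0 < ω) {x y : ℝ} (hxy : x < y) (hx : -√ω < x)
    (hy : y < √ω) :
    coef p * (expo p * ∫ t in (-x)..√ω, (ω - t ^ 2) ^ (expo p - 1))
      < coef p * (expo p * ∫ t in (-y)..√ω, (ω - t ^ 2) ^ (expo p - 1)) := by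
  have hi := intervalIntegrable_rpow (s := expo p - 1) (by linarith [one_le_expo hp hp4]) ω
  have hpos : 0 < ∫ t in (-y)..(-x), (ω - t ^ 2) ^ (expo p - 1) := by
    refine intervalIntegral.intervalIntegral_pos_of_pos_on (hi _ _) (fun t ht => ?_) (by linarith)
    have h1 : t ^ 2 < √ω ^ 2 := sq_lt_sq' (by linarith [ht.1]) (by linarith [ht.2])
    rw [Real.sq_sqrt hω.le] at h1
    exact Real.rpow_pos_of_pos (by linarith) _
  rw [← intervalIntegral.integral_add_adjacent_intervals (hi (-y) (-x)) (hi (-x) √ω)]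
  have h1 := coef_pos hp
  have h2 := expo_pos hp
  gcongr
  linarith

/-- A profile obeying the soliton flow whose boundary value and mass are those of a truncated
soliton is this truncated soliton: it lies above a soliton of at least the same mass. -/
lemma IsProfile.eq_soliton (h : IsProfile w γ) (hp : 2 < p) (hp4 : p ≤ 4) (hω : 0 < ω)
    (hflow : ∀ᵐ t ∂halfLine, γ t = w t * slopeAt p ω (w t)) {x₀ a : ℝ} (hx₀ : 0 ≤ x₀)
    (hmax : w x₀ = amplitude p ω) (hbd : slopeAt p ω (w 0) = solitonSlope p ω a)
    (hmass : ∫ x in Ioi 0, w x ^ 2 = ∫ x in Ioi 0, soliton p ω (x - a) ^ 2) :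
    ∀ x, 0 ≤ x → w x = soliton p ω (x - a) := by
  have hN := one_le_expo hp hp4
  have hle : ∀ x, 0 ≤ x → soliton p ω (x - x₀) ≤ w x := fun x hx =>
    h.soliton_le hp hω hflow hx₀ hmax hx
  have hsq : ∀ x, 0 ≤ x → soliton p ω (x - x₀) ^ 2 ≤ w x ^ 2 := fun x hx =>
    pow_le_pow_left₀ (soliton_pos hp hω _).le (hle x hx) 2
  have hsl : solitonSlope p ω a ≤ solitonSlope p ω x₀ := by
    have h0 := hle 0 le_rfl
    rw [zero_sub, soliton_neg] at h0
    have h1 : 0 ≤ solitonSlope p ω x₀ := by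
      rw [← solitonSlope_zero p ω]; exact (solitonSlope_strictMono hp hω).monotone hx₀
    rw [← hbd, ← abs_of_nonneg h1, ← slopeAt_soliton hp hω]
    refine Real.sqrt_le_sqrt ?_
    have h2 : 0 ≤ 2 / p := div_nonneg two_pos.le (by linarith)
    have h3 := Real.rpow_le_rpow (soliton_pos hp hω x₀).le h0 (by linarith : 0 ≤ p - 2)
    linarith [mul_le_mul_of_nonneg_left h3 h2]
  obtain ⟨i1, m1⟩ := soliton_mass hp hp4 hω x₀
  obtain ⟨-, m2⟩ := soliton_mass hp hp4 hω a
  have hmle : ∫ x in Ioi 0, soliton p ω (x - x₀) ^ 2 ≤ ∫ x in Ioi 0, w x ^ 2 :=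
    setIntegral_mono_on i1 h.integrable_sq measurableSet_Ioi fun x hx => hsq x (le_of_lt hx)
  have hx₀a : x₀ = a := by
    refine (solitonSlope_strictMono hp hω).injective (le_antisymm ?_ hsl)
    by_contra! hlt
    have := soliton_mass_lt hp hp4 hω hlt (Real.neg_sqrt_lt_of_sq_lt (solitonSlope_sq_lt hω a))
      (Real.lt_sqrt_of_sq_lt (solitonSlope_sq_lt hω x₀))
    rw [← m1, ← m2, ← hmass] at this
    linarith
  subst hx₀a
  have hz : ∫ x in Ioi 0, (w x ^ 2 - soliton p ω (x - x₀) ^ 2) = 0 := by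
    rw [integral_sub h.integrable_sq i1, hmass, sub_self]
  rw [setIntegral_eq_zero_iff_of_nonneg_ae ((ae_restrict_iff' measurableSet_Ioi).2
    (ae_of_all _ fun x hx => sub_nonneg.2 (hsq x (le_of_lt hx)))) (h.integrable_sq.sub i1)] at hz
  have hae : w =ᵐ[volume.restrict (Ici 0)] fun x => soliton p ω (x - x₀) := by
    rw [← restrict_Ioi_eq_restrict_Ici]
    filter_upwards [hz] with x hx
    have : w x ^ 2 - soliton p ω (x - x₀) ^ 2 = 0 := hx
    exact (pow_left_inj₀ (h.nonneg x) (soliton_pos hp hω _).le two_ne_zero).1 (by linarith)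
  exact Measure.eqOn_of_ae_eq hae h.continuousOn
    ((continuous_soliton hp hω).comp (continuous_sub_right x₀)).continuousOn
    (show Ici (0 : ℝ) ⊆ closure (interior (Ici 0)) by rw [interior_Ici, closure_Ioi])

end Comparison

/-! ### Truncated solitons as elements of `H¹` -/

section SolitonH1

variable {p α ω : ℝ}

/-- The derivative of the soliton. -/
noncomputable def solitonDeriv (p ω x : ℝ) : ℝ := -solitonSlope p ω x * soliton p ω x

lemma continuous_solitonDeriv (hp : 2 < p) (hω : 0 < ω) : Continuous (solitonDeriv p ω) :=
  (continuous_solitonSlope hp hω).neg.mul (continuous_soliton hp hω)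

section Field

variable (𝕜 : Type*) [RCLike 𝕜]

lemma isWeakDeriv_soliton (hp : 2 < p) (hω : 0 < ω) (a : ℝ) :
    IsWeakDeriv (fun x => (soliton p ω (x - a) : 𝕜)) (fun x => (solitonDeriv p ω (x - a) : 𝕜)) := by
  refine isWeakDeriv_of_hasDerivAt (fun x => ?_) ?_
  · exact (RCLike.ofRealCLM (K := 𝕜)).hasFDerivAt.comp_hasDerivAt x
      (hasDerivAt_sub_const_comp (hasDerivAt_soliton hp hω (x - a)))
  · exact RCLike.continuous_ofReal.comp
      ((continuous_solitonDeriv hp hω).comp (continuous_sub_right a))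

lemma memLp_ofReal {f : ℝ → ℝ} (hf : Continuous f)
    (hi : IntegrableOn (fun x => f x ^ 2) (Ioi 0)) :
    MemLp (fun x => (f x : 𝕜)) 2 halfLine := by
  rw [memLp_two_iff_integrable_sq_norm (RCLike.continuous_ofReal.comp hf).aestronglyMeasurable]
  simpa [IntegrableOn, RCLike.norm_ofReal, sq_abs] using hi

lemma memH1_soliton (hp : 2 < p) (hp4 : p ≤ 4) (hω : 0 < ω) (a : ℝ) :
    MemH1 (fun x => (soliton p ω (x - a) : 𝕜)) :=
  ⟨(RCLike.continuous_ofReal.comp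
      ((continuous_soliton hp hω).comp (continuous_sub_right a))).continuousOn,
    memLp_ofReal 𝕜 ((continuous_soliton hp hω).comp (continuous_sub_right a))
      (soliton_mass hp hp4 hω a).1,
    _, isWeakDeriv_soliton 𝕜 hp hω a,
    memLp_ofReal 𝕜 ((continuous_solitonDeriv hp hω).comp (continuous_sub_right a))
      (soliton_kinetic hp hω a).1⟩

lemma mass_ofReal (f : ℝ → ℝ) : mass (fun x => (f x : 𝕜)) = ∫ x in Ioi 0, f x ^ 2 := by
  simp [mass, sq_abs]

/-- The energy of a truncated soliton, with the slope as variable of integration. -/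
lemma energy_soliton (hp : 2 < p) (hp4 : p ≤ 4) (hω : 0 < ω) (α a : ℝ) :
    energy p α (fun x => (soliton p ω (x - a) : 𝕜))
      = coef p / 2 * (∫ y in (-solitonSlope p ω a)..√ω, (ω - y ^ 2) ^ expo p)
        + (α - solitonSlope p ω a) * soliton p ω a ^ 2 / 2
        - ω / 2 * ∫ x in Ioi 0, soliton p ω (x - a) ^ 2 := by
  obtain ⟨im, -⟩ := soliton_mass hp hp4 hω a
  obtain ⟨ik, ek⟩ := soliton_kinetic hp hω a
  have hp0 : p ≠ 0 := by linarith
  have h1 : ∫ x in Ioi 0, ‖weakDeriv (fun x => (soliton p ω (x - a) : 𝕜)) x‖ ^ 2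
      = ∫ x in Ioi 0, (-solitonSlope p ω (x - a) * soliton p ω (x - a)) ^ 2 := by
    refine integral_congr_ae ?_
    filter_upwards [(isWeakDeriv_soliton 𝕜 hp hω a).weakDeriv_ae_eq] with x hx
    rw [hx, RCLike.norm_ofReal, sq_abs, solitonDeriv]
  have h2 : ∫ x in Ioi 0, ‖(soliton p ω (x - a) : 𝕜)‖ ^ p
      = p / 2 * (ω * (∫ x in Ioi 0, soliton p ω (x - a) ^ 2)
        - ∫ x in Ioi 0, (-solitonSlope p ω (x - a) * soliton p ω (x - a)) ^ 2) := by
    rw [← integral_const_mul, ← integral_sub (im.const_mul ω) ik, ← integral_const_mul]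
    refine integral_congr_ae (ae_of_all _ fun x => ?_)
    simp only [RCLike.norm_ofReal, abs_of_pos (soliton_pos hp hω (x - a)),
      soliton_rpow_self hp hω]
    ring
  rw [energy, h1, h2, ek, RCLike.norm_ofReal, sq_abs, zero_sub, soliton_neg]
  field_simp
  ring

end Field

/-- A truncated soliton with the right slope at the boundary is a bound state. -/
lemma isBoundStateAt_soliton (hp : 2 < p) (hp4 : p ≤ 4) (hω : 0 < ω) {a : ℝ}
    (ha : solitonSlope p ω a = α) : IsBoundStateAt p α ω (fun x => soliton p ω (x - a)) := by
  have hcs := (continuous_soliton hp hω).comp (continuous_sub_right a)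
  refine ⟨by simpa using memH1_soliton ℝ hp hp4 hω a, fun x => solitonDeriv p ω (x - a),
    fun x => ω * soliton p ω (x - a) - |soliton p ω (x - a)| ^ (p - 2) * soliton p ω (x - a),
    by simpa using isWeakDeriv_soliton ℝ hp hω a,
    ((continuous_solitonDeriv hp hω).comp (continuous_sub_right a)).continuousOn,
    isWeakDeriv_of_hasDerivAt (fun x => ?_) ?_, fun x _ => by ring, ?_⟩
  · have h := hasDerivAt_sub_const_comp ((hasDerivAt_solitonSlope hp hω (x - a)).neg.mul
      (hasDerivAt_soliton hp hω (x - a)))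
    refine h.congr_deriv ?_
    rw [abs_of_pos (soliton_pos hp hω _), soliton_rpow hp hω, expo]
    have : p - 2 ≠ 0 := by linarith
    simp only [Pi.neg_apply]
    field_simp
    ring
  · exact (continuous_const.mul hcs).sub
      ((hcs.abs.rpow_const fun _ => Or.inr (by linarith)).mul hcs)
  · simp only [solitonDeriv, zero_sub, solitonSlope_neg, ha, neg_neg]

end SolitonH1

/-! ### Classification of positive bound states -/

section BoundState

variable {p α ω : ℝ}

/-- A continuous weak derivative is a classical derivative. -/
lemma IsWeakDeriv.hasDerivAt {u g : ℝ → ℝ} (h : IsWeakDeriv u g) (hu : ContinuousOn u (Ioi 0))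
    (hg : ContinuousOn g (Ioi 0)) {x : ℝ} (hx : 0 < x) : HasDerivAt u (g x) x := by
  have hx2 : 0 < x / 2 := by positivity
  have hi : IntervalIntegrable g volume (x / 2) x :=
    ContinuousOn.intervalIntegrable
      (hg.mono (by rw [uIcc_of_le (by linarith)]; exact fun t ht => hx2.trans_le ht.1))
  have hd : HasDerivAt (fun y => u (x / 2) + ∫ t in (x / 2)..y, g t) (g x) x := by
    refine (intervalIntegral.integral_hasDerivAt_right hi ?_
      (hg.continuousAt (Ioi_mem_nhds hx))).const_add _
    exact hg.stronglyMeasurableAtFilter isOpen_Ioi x hx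
  refine hd.congr_of_eventuallyEq ?_
  filter_upwards [Ioi_mem_nhds (by linarith : x / 2 < x)] with y hy
  rw [← h.sub_eq_integral hu hx2 hy]
  ring

lemma exists_const_of_hasDerivAt_zero {f : ℝ → ℝ} (h : ∀ x, 0 < x → HasDerivAt f 0 x) :
    ∃ C, ∀ x, 0 < x → f x = C := by
  refine ⟨f 1, fun x hx => ?_⟩
  exact isOpen_Ioi.is_const_of_deriv_eq_zero isPreconnected_Ioi
    (fun y hy => (h y hy).differentiableAt.differentiableWithinAt) (fun y hy => (h y hy).deriv) hx
    (show (1 : ℝ) ∈ Ioi 0 by simp)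

/-- Positive bound states are truncated solitons: the first integral of the equation turns it into
an autonomous first order equation for the logarithmic derivative. -/
lemma IsBoundStateAt.eq_soliton (hp : 2 < p) (hω : 0 < ω) {v : ℝ → ℝ}
    (hv : IsBoundStateAt p α ω v) (hpos : IsPositive v) :
    ∃ a, solitonSlope p ω a = α ∧ ∀ x, 0 ≤ x → v x = soliton p ω (x - a) := by
  obtain ⟨hH1, v', v'', hv', hv'c, hv'', heq, hbc⟩ := hv
  have hp0 : 0 < p := by linarith
  have hsub : Ioi (0 : ℝ) ⊆ Ici 0 := Ioi_subset_Ici_self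
  have hvc : ContinuousOn v (Ioi 0) := hH1.1.mono hsub
  have eq2 : ∀ x, 0 < x → v'' x = ω * v x - v x ^ (p - 2) * v x := fun x hx => by
    have := heq x hx
    rw [abs_of_pos (hpos x hx)] at this
    linarith
  have hd1 : ∀ x, 0 < x → HasDerivAt v (v' x) x := fun x hx =>
    hv'.hasDerivAt hvc (hv'c.mono hsub) hx
  have hv''c : ContinuousOn v'' (Ioi 0) := by
    refine ContinuousOn.congr ?_ (fun x hx => eq2 x hx)
    exact (continuousOn_const.mul hvc).sub
      ((hvc.rpow_const fun x hx => Or.inl (hpos x hx).ne').mul hvc)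
  have hd2 : ∀ x, 0 < x → HasDerivAt v' (ω * v x - v x ^ (p - 2) * v x) x := fun x hx => by
    rw [← eq2 x hx]; exact hv''.hasDerivAt (hv'c.mono hsub) hv''c hx
  -- the conserved energy density, zero because it is integrable
  obtain ⟨C, hC⟩ := exists_const_of_hasDerivAt_zero
    (f := fun x => v' x ^ 2 - ω * v x ^ 2 + 2 / p * v x ^ p) (fun x hx => by
      have h := (((hd2 x hx).pow 2).sub (((hd1 x hx).pow 2).const_mul ω)).add
        (((hd1 x hx).rpow_const (p := p) (Or.inl (hpos x hx).ne')).const_mul (2 / p))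
      refine h.congr_deriv ?_
      have e : v x ^ (p - 1) = v x ^ (p - 2) * v x := by
        rw [← Real.rpow_add_one (hpos x hx).ne']; ring_nf
      rw [e]
      simp only [Nat.cast_ofNat, Nat.add_one_sub_one, pow_one]
      field_simp
      ring)
  have hP := hH1.isProfile
  have hC0 : C = 0 := by
    have i1 : IntegrableOn (fun x => v' x ^ 2) (Ioi 0) := by
      have h1 : MemLp v' 2 halfLine := (hH1.exists_weakDeriv.2).ae_eq hv'.weakDeriv_ae_eq
      exact h1.integrable_sq
    have i2 : IntegrableOn (fun x => v x ^ 2) (Ioi 0) := hH1.2.1.integrable_sq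
    have i3 : IntegrableOn (fun x => v x ^ p) (Ioi 0) :=
      (hP.rpow_integrable hp).congr_fun (fun x hx => by
        simp only [Real.norm_eq_abs, abs_of_pos (hpos x hx)]) measurableSet_Ioi
    have i4 : IntegrableOn (fun _ => C) (Ioi (0 : ℝ)) :=
      ((i1.sub (i2.const_mul ω)).add (i3.const_mul (2 / p))).congr_fun
        (fun x hx => hC x hx) measurableSet_Ioi
    rw [integrableOn_const_iff] at i4
    simpa using i4
  subst hC0
  -- the negative logarithmic derivative, which solves a Riccati equation
  let X : ℝ → ℝ := fun x => -v' x / v x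
  have hvp : ∀ x, 0 < x → 0 < v x ^ (p - 2) := fun x hx => Real.rpow_pos_of_pos (hpos x hx) _
  have hXsq : ∀ x, 0 < x → X x ^ 2 = ω - 2 / p * v x ^ (p - 2) := by
    intro x hx
    have h := hC x hx
    have hv0 := (hpos x hx).ne'
    have e : v x ^ p = v x ^ (p - 2) * v x ^ 2 := by
      rw [← Real.rpow_natCast, ← Real.rpow_add (hpos x hx)]; norm_num
    rw [e] at h
    simp only [X, div_pow, neg_sq]
    rw [div_eq_iff (pow_ne_zero 2 hv0)]
    linarith
  have hXlt : ∀ x, 0 < x → X x / √ω ∈ Ioo (-1 : ℝ) 1 := by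
    intro x hx
    have h0 := Real.sqrt_pos.2 hω
    have h1 : X x ^ 2 < ω := by
      rw [hXsq x hx]
      have : 0 < 2 / p * v x ^ (p - 2) := mul_pos (by positivity) (hvp x hx)
      linarith
    have h2 := Real.lt_sqrt_of_sq_lt h1
    have h3 := Real.neg_sqrt_lt_of_sq_lt h1
    exact ⟨by rw [lt_div_iff₀ h0]; linarith, by rw [div_lt_iff₀ h0]; linarith⟩
  have hXd : ∀ x, 0 < x → HasDerivAt X ((ω - X x ^ 2) / expo p) x := by
    intro x hx
    have hv0 := (hpos x hx).ne'
    refine ((hd2 x hx).neg.div (hd1 x hx) hv0).congr_deriv ?_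
    have e1 : (-(ω * v x - v x ^ (p - 2) * v x) * v x - (-v') x * v' x) / v x ^ 2
        = -(ω - v x ^ (p - 2)) + X x ^ 2 := by
      simp only [X, Pi.neg_apply]
      field_simp
      ring
    have : p - 2 ≠ 0 := by linarith
    rw [e1, hXsq x hx, expo]
    field_simp
    ring
  have hk : 0 < (p / 2 - 1) * √ω := mul_pos (by linarith) (Real.sqrt_pos.2 hω)
  obtain ⟨D, hD⟩ := exists_const_of_hasDerivAt_zero
    (f := fun x => Real.artanh (X x / √ω) / ((p / 2 - 1) * √ω) - x) (fun x hx => by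
      have h := (((hasDerivAt_artanh (hXlt x hx)).comp x ((hXd x hx).div_const √ω)).div_const
        ((p / 2 - 1) * √ω)).sub (hasDerivAt_id x)
      refine h.congr_deriv ?_
      have h0 := (Real.sqrt_pos.2 hω).ne'
      have h1 : ω - X x ^ 2 ≠ 0 := by
        rw [hXsq x hx]
        have : 0 < 2 / p * v x ^ (p - 2) := mul_pos (by positivity) (hvp x hx)
        linarith
      have h2 : 1 / (1 - (X x / √ω) ^ 2) = ω / (ω - X x ^ 2) := by
        rw [div_pow, Real.sq_sqrt hω.le]
        field_simp
      have hs := Real.mul_self_sqrt hω.le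
      have hr := rate_mul_expo hp ω
      have hN := (expo_pos hp).ne'
      rw [h2, sub_eq_zero, div_eq_iff hk.ne', one_mul]
      field_simp
      linear_combination (-2 * √ω) * hr - 2 * hs)
  have hX : ∀ x, 0 < x → X x = solitonSlope p ω (x - -D) := by
    intro x hx
    have h := hD x hx
    have h1 : Real.artanh (X x / √ω) = (p / 2 - 1) * √ω * (x - -D) := by
      have : Real.artanh (X x / √ω) / ((p / 2 - 1) * √ω) = x - -D := by linarith
      rw [div_eq_iff hk.ne'] at this
      rw [this]; ring
    rw [solitonSlope, ← h1, Real.tanh_artanh (hXlt x hx),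
      mul_div_cancel₀ _ (Real.sqrt_pos.2 hω).ne']
  have hpt : ∀ x, 0 < x → v x = soliton p ω (x - -D) := by
    intro x hx
    refine eq_soliton_of_rpow hp hω (hpos x hx).le ?_
    rw [← hX x hx, hXsq x hx]
    field_simp
    ring
  have hcl : ∀ f g : ℝ → ℝ, ContinuousOn f (Ici 0) → ContinuousOn g (Ici 0) →
      (∀ x, 0 < x → f x = g x) → EqOn f g (Ici 0) := fun f g hf hg h =>
    EqOn.of_subset_closure (s := Ioi 0) (fun x hx => h x hx) hf hg hsub (by rw [closure_Ioi])
  have hcs : Continuous fun x => soliton p ω (x - -D) :=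
    (continuous_soliton hp hω).comp (continuous_sub_right _)
  have hall := hcl v _ hH1.1 hcs.continuousOn hpt
  refine ⟨-D, ?_, hall⟩
  have hall' := hcl v' (fun x => solitonDeriv p ω (x - -D)) hv'c
    ((continuous_solitonDeriv hp hω).comp (continuous_sub_right _)).continuousOn (fun x hx => by
      rw [solitonDeriv, ← hX x hx, ← hpt x hx]
      have := (hpos x hx).ne'
      simp only [X]
      field_simp)
  have h0 : v 0 = soliton p ω (0 - -D) := hall (show (0 : ℝ) ∈ Ici 0 by simp)
  have h0' : v' 0 = solitonDeriv p ω (0 - -D) := hall' (show (0 : ℝ) ∈ Ici 0 by simp)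
  have hs := soliton_pos hp hω (0 - -D)
  rw [h0', h0, solitonDeriv] at hbc
  have := mul_right_cancel₀ hs.ne' hbc
  rw [zero_sub, solitonSlope_neg, neg_neg] at this
  exact this

end BoundState

/-! ### Energy levels -/

section Level

variable {p α μ ω ω₀ : ℝ}

/-- The lower bound for the energy at mass `μ` among functions with the maximum of the soliton of
frequency `ω`. -/
noncomputable def level (p α μ ω : ℝ) : ℝ := coef p / 2 * action α (expo p) ω - ω / 2 * μ

/-- The level is smallest at the frequency whose least action state has mass `μ`. -/
lemma level_lt_level (hp : 2 < p) (hp4 : p ≤ 4) (hα : 0 < α) (hω : 0 < ω) (hω₀ : 0 < ω₀)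
    (hμ : coef p * (expo p * massIntegral α (expo p) ω₀) = μ) (hne : ω ≠ ω₀) :
    level p α μ ω₀ < level p α μ ω := by
  have h := mul_lt_mul_of_pos_left (action_tangent_lt (one_le_expo hp hp4) hα hω hω₀ hne)
    (half_pos (coef_pos hp))
  rw [level, level, ← hμ]
  linarith

/-- The minimal level bounds the energy from below; functions attaining it follow the soliton flow,
have the maximum of the soliton and the optimal slope at the boundary. -/
lemma level_le_energy {𝕜 : Type*} [RCLike 𝕜] (hp : 2 < p) (hp4 : p ≤ 4) (hα : 0 < α) (hμ : 0 < μ)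
    (hω₀ : 0 < ω₀) (hmass : coef p * (expo p * massIntegral α (expo p) ω₀) = μ) {u : ℝ → 𝕜}
    (hu : MemH1 u) (hum : mass u = μ) :
    level p α μ ω₀ ≤ energy p α u ∧ (energy p α u ≤ level p α μ ω₀ →
      (∃ x₀, 0 ≤ x₀ ∧ ‖u x₀‖ = amplitude p ω₀) ∧
      (∀ᵐ t ∂halfLine, ‖weakDeriv u t‖ = ‖u t‖ * slopeAt p ω₀ ‖u t‖) ∧
      slopeAt p ω₀ ‖u 0‖ = min α √ω₀) := by
  have hP := hu.isProfile
  obtain ⟨x₀, hx₀, hpos, hmax⟩ := hP.exists_max (by change 0 < mass u; rw [hum]; exact hμ)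
  obtain ⟨h1, h2⟩ := hP.action_le_profileEnergy hp hα hx₀ hpos hmax
  set ω := freqOf p ‖u x₀‖ with hω_def
  have hω : 0 < ω := freqOf_pos hp hpos
  have hA : amplitude p ω = ‖u x₀‖ := amplitude_freqOf hp hpos
  have e1 : profileEnergy p α (fun x => ‖u x‖) (fun x => ‖weakDeriv u x‖) = energy p α u := rfl
  have e2 : ∫ x in Ioi 0, ‖u x‖ ^ 2 = μ := hum
  simp only [e1, e2] at h1 h2
  change level p α μ ω ≤ energy p α u at h1
  by_cases hne : ω = ω₀
  · rw [← hne]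
    exact ⟨h1, fun hle => ⟨⟨x₀, hx₀, hA.symm⟩, h2 hle⟩⟩
  · have h3 := level_lt_level hp hp4 hα hω hω₀ hmass hne
    exact ⟨by linarith, fun hle => by linarith⟩

end Level

/-! ### Truncated solitons of prescribed mass -/

section PrescribedMass

variable {p α μ ω : ℝ}

/-- The truncated beta integral. For `s = N - 1` it is, up to normalization, the mass of the soliton
of frequency one truncated where its logarithmic derivative is `τ`. -/
noncomputable def truncBeta (s τ : ℝ) : ℝ := ∫ q in (-τ)..1, (1 - q ^ 2) ^ s

lemma continuous_truncBeta {s : ℝ} (hs : 0 ≤ s) : Continuous (truncBeta s) := by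
  have hc : Continuous fun x => ∫ y in (0 : ℝ)..x, (1 - y ^ 2) ^ s :=
    continuous_iff_continuousAt.2 fun x => (hasDerivAt_integral_rpow hs 1 x).continuousAt
  have e : truncBeta s = fun τ => (∫ y in (0 : ℝ)..1, (1 - y ^ 2) ^ s)
      - ∫ y in (0 : ℝ)..(-τ), (1 - y ^ 2) ^ s := by
    ext τ
    rw [truncBeta, intervalIntegral.integral_interval_sub_left] <;>
      exact intervalIntegrable_rpow hs _ _ _
  rw [e]
  exact continuous_const.sub (hc.comp continuous_neg)

lemma truncBeta_mono {s : ℝ} (hs : 0 ≤ s) {σ τ : ℝ} (hστ : σ ≤ τ) (hτ : τ ≤ 1)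
    (hσ : -1 ≤ σ) : truncBeta s σ ≤ truncBeta s τ := by
  have hi := intervalIntegrable_rpow hs 1
  rw [truncBeta, truncBeta,
    ← intervalIntegral.integral_add_adjacent_intervals (hi (-τ) (-σ)) (hi (-σ) 1)]
  have : 0 ≤ ∫ q in (-τ)..(-σ), (1 - q ^ 2) ^ s :=
    intervalIntegral.integral_nonneg (by linarith) fun q hq =>
      Real.rpow_nonneg (by nlinarith [hq.1, hq.2]) _
  linarith

lemma truncBeta_pos {s : ℝ} (hs : 0 ≤ s) {τ : ℝ} (hτ : 0 ≤ τ) (hτ1 : τ ≤ 1) :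
    0 < truncBeta s τ := by
  refine lt_of_lt_of_le ?_ (truncBeta_mono hs hτ hτ1 (by norm_num))
  rw [truncBeta, neg_zero]
  refine intervalIntegral.intervalIntegral_pos_of_pos_on (intervalIntegrable_rpow hs _ _ _)
    (fun q hq => ?_) one_pos
  exact Real.rpow_pos_of_pos (by nlinarith [hq.1, hq.2]) _

lemma integral_rpow_eq_truncBeta (hω : 0 < ω) (s : ℝ) {τ : ℝ} (h0 : 0 ≤ τ) (h1 : τ ≤ 1) :
    ∫ y in (-(√ω * τ))..√ω, (ω - y ^ 2) ^ s = ω ^ (s + 1 / 2) * truncBeta s τ :=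
  integral_rpow_scale hω s (abs_le.2 ⟨by linarith, h1⟩)

/-- The frequency `ω` for which the soliton truncated where its logarithmic derivative is `√ω τ` has
mass `μ`. -/
noncomputable def massFreq (p μ τ : ℝ) : ℝ :=
  (μ / (coef p * (expo p * truncBeta (expo p - 1) τ))) ^ (1 / (expo p - 1 / 2))

lemma massFreq_pos (hp : 2 < p) (hp4 : p ≤ 4) (hμ : 0 < μ) {τ : ℝ} (h0 : 0 ≤ τ) (h1 : τ ≤ 1) :
    0 < massFreq p μ τ := by
  have := coef_pos hp
  have := expo_pos hp
  have := truncBeta_pos (s := expo p - 1) (by linarith [one_le_expo hp hp4]) h0 h1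
  exact Real.rpow_pos_of_pos (by positivity) _

lemma mass_massFreq (hp : 2 < p) (hp4 : p ≤ 4) (hμ : 0 < μ) {τ : ℝ} (h0 : 0 ≤ τ) (h1 : τ ≤ 1) :
    coef p * (expo p * (massFreq p μ τ ^ (expo p - 1 / 2) * truncBeta (expo p - 1) τ)) = μ := by
  have hK := coef_pos hp
  have hN := one_le_expo hp hp4
  have hN0 := expo_pos hp
  have hJ := truncBeta_pos (s := expo p - 1) (by linarith) h0 h1
  rw [massFreq, ← Real.rpow_mul (by positivity), one_div_mul_cancel (by linarith), Real.rpow_one]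
  field_simp

lemma continuousOn_massFreq (hp : 2 < p) (hp4 : p ≤ 4) :
    ContinuousOn (massFreq p μ) (Icc 0 1) := by
  have hN := one_le_expo hp hp4
  refine ContinuousOn.rpow_const (ContinuousOn.div continuousOn_const ?_ ?_) ?_
  · exact (continuous_const.mul (continuous_const.mul
      (continuous_truncBeta (by linarith)))).continuousOn
  · intro τ hτ
    have hJ := truncBeta_pos (s := expo p - 1) (by linarith) hτ.1 hτ.2
    exact (mul_pos (coef_pos hp) (mul_pos (expo_pos hp) hJ)).ne'
  · exact fun _ _ => Or.inr (one_div_nonneg.2 (by linarith))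

/-- The energy of the soliton of mass `μ` truncated where its logarithmic derivative is the
fraction `τ` of its supremum `√ω`. -/
noncomputable def truncEnergy (p α μ τ : ℝ) : ℝ :=
  coef p / 2 * (massFreq p μ τ ^ (expo p + 1 / 2) * truncBeta (expo p) τ)
    + (α - √(massFreq p μ τ) * τ)
      * (coef p * (massFreq p μ τ - massFreq p μ τ * τ ^ 2) ^ expo p) / 2
    - massFreq p μ τ / 2 * μ

lemma exists_truncated_soliton (𝕜 : Type*) [RCLike 𝕜] (hp : 2 < p) (hp4 : p ≤ 4) (hμ : 0 < μ)
    {τ : ℝ} (h0 : 0 ≤ τ) (h1 : τ < 1) :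
    ∃ v : ℝ → 𝕜, MemH1 v ∧ mass v = μ ∧ energy p α v = truncEnergy p α μ τ := by
  have hω := massFreq_pos hp hp4 hμ h0 h1.le
  have hsq : (√(massFreq p μ τ) * τ) ^ 2 = massFreq p μ τ * τ ^ 2 := by
    rw [mul_pow, Real.sq_sqrt hω.le]
  obtain ⟨a, ha⟩ := exists_solitonSlope_eq hp hω (y := √(massFreq p μ τ) * τ) (by
    rw [hsq]; exact mul_lt_of_lt_one_right hω (by nlinarith))
  have hm : ∫ x in Ioi 0, soliton p (massFreq p μ τ) (x - a) ^ 2 = μ := by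
    rw [(soliton_mass hp hp4 hω a).2, ha, integral_rpow_eq_truncBeta hω _ h0 h1.le,
      show expo p - 1 + 1 / 2 = expo p - 1 / 2 by ring, mass_massFreq hp hp4 hμ h0 h1.le]
  refine ⟨fun x => (soliton p (massFreq p μ τ) (x - a) : 𝕜), memH1_soliton 𝕜 hp hp4 hω a,
    (mass_ofReal 𝕜 _).trans hm, ?_⟩
  rw [energy_soliton 𝕜 hp hp4 hω, hm, ha, integral_rpow_eq_truncBeta hω _ h0 h1.le,
    soliton_sq hp hω, ha, hsq, truncEnergy]

lemma tendsto_truncEnergy (hp : 2 < p) (hp4 : p ≤ 4) :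
    Tendsto (truncEnergy p α μ) (𝓝[<] 1) (𝓝 (coef p / 2 *
      (massFreq p μ 1 ^ (expo p + 1 / 2) * truncBeta (expo p) 1) - massFreq p μ 1 / 2 * μ)) := by
  have hN := expo_pos hp
  have hw : ContinuousOn (massFreq p μ) (Icc 0 1) := continuousOn_massFreq hp hp4
  have hc : ContinuousOn (truncEnergy p α μ) (Icc 0 1) := by
    have hid : ContinuousOn (fun τ : ℝ => τ) (Icc 0 1) := continuousOn_id
    refine ((continuousOn_const.mul ((hw.rpow_const fun _ _ => Or.inr (by linarith)).mul
      (continuous_truncBeta hN.le).continuousOn)).add ?_).sub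
      ((hw.div_const 2).mul continuousOn_const)
    refine ContinuousOn.div_const (ContinuousOn.mul ?_ ?_) 2
    · exact continuousOn_const.sub (hw.sqrt.mul hid)
    · exact continuousOn_const.mul ((hw.sub (hw.mul (hid.pow 2))).rpow_const
        fun _ _ => Or.inr hN.le)
  have h1 : Tendsto (truncEnergy p α μ) (𝓝[<] 1) (𝓝 (truncEnergy p α μ 1)) := by
    rw [← nhdsWithin_Ioo_eq_nhdsLT (zero_lt_one (α := ℝ))]
    exact (hc 1 ⟨zero_le_one, le_rfl⟩).mono Ioo_subset_Icc_self
  convert h1 using 2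
  rw [truncEnergy, one_pow, mul_one, mul_one, sub_self, Real.zero_rpow hN.ne']
  ring

/-- The critical mass, with the slope as variable of integration. -/
lemma integral_soliton_sq (hp : 2 < p) (hp4 : p ≤ 4) (hω : 0 < ω) :
    ∫ x : ℝ, soliton p ω x ^ 2
      = coef p * (expo p * (ω ^ (expo p - 1 / 2) * truncBeta (expo p - 1) 1)) := by
  have hN := one_le_expo hp hp4
  have h1 : ∫ x : ℝ, soliton p ω x ^ 2 = 2 * ∫ x in Ioi 0, soliton p ω x ^ 2 := by
    rw [← integral_comp_abs (f := fun x => soliton p ω x ^ 2)]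
    simp only [soliton, abs_abs]
  have h2 := (soliton_mass hp hp4 hω 0).2
  simp only [sub_zero, solitonSlope_zero, neg_zero] at h2
  have hi := intervalIntegrable_rpow (s := expo p - 1) (by linarith) ω
  have h3 : ∫ y in (-√ω)..√ω, (ω - y ^ 2) ^ (expo p - 1)
      = 2 * ∫ y in (0 : ℝ)..√ω, (ω - y ^ 2) ^ (expo p - 1) := by
    have h := intervalIntegral.integral_comp_neg (a := 0) (b := √ω)
      (fun y : ℝ => (ω - y ^ 2) ^ (expo p - 1))
    simp only [neg_sq, neg_zero] at h
    rw [← intervalIntegral.integral_add_adjacent_intervals (hi (-√ω) 0) (hi 0 √ω), ← h]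
    ring
  have h4 := integral_rpow_eq_truncBeta hω (expo p - 1) zero_le_one le_rfl
  rw [mul_one, h3, show expo p - 1 + 1 / 2 = expo p - 1 / 2 by ring] at h4
  rw [h1, h2, ← h4]
  ring

/-- Above the critical mass some frequency larger than `α²` carries a bound state of mass `μ`. -/
lemma exists_freq_of_lt (hp : 2 < p) (hp4 : p ≤ 4) (hα : 0 < α)
    (hμ : ∫ x : ℝ, soliton p (α ^ 2) x ^ 2 < μ) :
    ∃ ω, α ^ 2 < ω ∧
      coef p * (expo p * ∫ y in (-α)..√ω, (ω - y ^ 2) ^ (expo p - 1)) = μ := by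
  have hK := coef_pos hp
  have hN0 := expo_pos hp
  have hN := one_le_expo hp hp4
  have hα2 : 0 < α ^ 2 := by positivity
  let g : ℝ → ℝ := fun ω =>
    coef p * (expo p * (ω ^ (expo p - 1 / 2) * truncBeta (expo p - 1) (α / √ω)))
  have hτ : ∀ ω, α ^ 2 ≤ ω → 0 < √ω ∧ 0 ≤ α / √ω ∧ α / √ω ≤ 1 := by
    intro ω hω
    have h0 : 0 < √ω := Real.sqrt_pos.2 (hα2.trans_le hω)
    exact ⟨h0, by positivity, (div_le_one h0).2 (Real.le_sqrt_of_sq_le hω)⟩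
  have hg1 : g (α ^ 2) < μ := by
    rw [integral_soliton_sq hp hp4 hα2] at hμ
    simpa only [g, Real.sqrt_sq hα.le, div_self hα.ne'] using hμ
  have hcont : ∀ W, ContinuousOn g (Icc (α ^ 2) W) := by
    intro W
    refine continuousOn_const.mul (continuousOn_const.mul (ContinuousOn.mul ?_ ?_))
    · exact (Real.continuous_rpow_const (by linarith)).continuousOn
    · refine (continuous_truncBeta (by linarith)).comp_continuousOn ?_
      exact continuousOn_const.div Real.continuous_sqrt.continuousOn
        fun ω hω => (hτ ω hω.1).1.ne'
  have hlow : ∀ ω, α ^ 2 ≤ ω → coef p * (expo p * (ω ^ (expo p - 1 / 2)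
      * truncBeta (expo p - 1) 0)) ≤ g ω := by
    intro ω hω
    obtain ⟨-, h1, h2⟩ := hτ ω hω
    have := truncBeta_mono (s := expo p - 1) (by linarith) h1 h2 (by norm_num)
    have hω0 : 0 ≤ ω := hα2.le.trans hω
    simp only [g]
    gcongr
  have hlim : Tendsto (fun ω : ℝ => coef p * (expo p * (ω ^ (expo p - 1 / 2)
      * truncBeta (expo p - 1) 0))) atTop atTop :=
    (((tendsto_rpow_atTop (by linarith : 0 < expo p - 1 / 2)).atTop_mul_const
      (truncBeta_pos (by linarith) le_rfl zero_le_one)).const_mul_atTop hN0).const_mul_atTop hK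
  obtain ⟨W, hW1, hW2⟩ := ((hlim.eventually_ge_atTop μ).and (eventually_ge_atTop (α ^ 2))).exists
  obtain ⟨ω, hω, hgω⟩ := intermediate_value_Icc hW2 (hcont W) ⟨hg1.le, hW1.trans (hlow W hW2)⟩
  obtain ⟨h0, h1, h2⟩ := hτ ω hω.1
  refine ⟨ω, lt_of_le_of_ne hω.1 fun h => ?_, ?_⟩
  · rw [← h] at hgω; exact hg1.ne hgω
  · have h := integral_rpow_eq_truncBeta (hα2.trans_le hω.1) (expo p - 1) h1 h2
    rw [mul_div_cancel₀ _ h0.ne', show expo p - 1 + 1 / 2 = expo p - 1 / 2 by ring] at h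
    rw [h]
    exact hgω

end PrescribedMass

/-! ### Existence, uniqueness and nonexistence of ground states -/

section GroundState

variable {p α μ ω : ℝ}

lemma min_eq_of_sq_lt (hα : 0 < α) (hω : α ^ 2 < ω) : min α √ω = α :=
  min_eq_left ((Real.lt_sqrt hα.le).2 hω).le

/-- Below the critical mass there is no ground state: solitons escaping to infinity have energies
approaching the minimal level, but a function attaining it would have to vanish at the boundary. -/
lemma not_isGroundState {𝕜 : Type*} [RCLike 𝕜] (hp : 2 < p) (hp4 : p ≤ 4) (hα : 0 < α) (hμ : 0 < μ)
    (hμc : μ ≤ ∫ x : ℝ, soliton p (α ^ 2) x ^ 2) (u : ℝ → 𝕜) : ¬ IsGroundState p α μ u := by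
  rintro ⟨hu, hum, hmin⟩
  have hK := coef_pos hp
  have hN0 := expo_pos hp
  have hN := one_le_expo hp hp4
  have hω := massFreq_pos hp hp4 hμ zero_le_one le_rfl
  have hmf := mass_massFreq hp hp4 hμ zero_le_one le_rfl
  set ω := massFreq p μ 1 with hω_def
  have hJ := truncBeta_pos (s := expo p - 1) (by linarith) zero_le_one le_rfl
  have hωα : ω ≤ α ^ 2 := by
    rw [integral_soliton_sq hp hp4 (by positivity), ← hmf] at hμc
    have h1 := le_of_mul_le_mul_left (le_of_mul_le_mul_left hμc hK) hN0
    have h2 := le_of_mul_le_mul_right h1 hJ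
    exact (Real.rpow_le_rpow_iff hω.le (by positivity) (by linarith)).1 h2
  have hmin' : min α √ω = √ω := min_eq_right ((Real.sqrt_le_left hα.le).2 hωα)
  have hscale : ∀ s, ∫ y in (-√ω)..√ω, (ω - y ^ 2) ^ s = ω ^ (s + 1 / 2) * truncBeta s 1 := by
    intro s
    rw [← integral_rpow_eq_truncBeta hω s zero_le_one le_rfl, mul_one]
  have hmass : coef p * (expo p * massIntegral α (expo p) ω) = μ := by
    rw [massIntegral, hmin', hscale, show expo p - 1 + 1 / 2 = expo p - 1 / 2 by ring, hmf]
  have hlev : level p α μ ω = coef p / 2 * (ω ^ (expo p + 1 / 2) * truncBeta (expo p) 1)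
      - ω / 2 * μ := by
    rw [level, action_eq hN0 hα hω, hmin', hscale]
  have hle : energy p α u ≤ level p α μ ω := by
    rw [hlev]
    refine ge_of_tendsto (tendsto_truncEnergy (α := α) (μ := μ) hp hp4) ?_
    filter_upwards [Ioo_mem_nhdsLT zero_lt_one] with τ hτ
    obtain ⟨v, hv1, hv2, hv3⟩ := exists_truncated_soliton (α := α) 𝕜 hp hp4 hμ hτ.1.le hτ.2
    rw [← hv3]
    exact hmin v hv1 hv2
  obtain ⟨⟨x₀, hx₀, hmax⟩, hflow, hbd⟩ :=
    (level_le_energy hp hp4 hα hμ hω hmass hu hum).2 hle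
  have hpos := (soliton_pos hp hω _).trans_le (hu.isProfile.soliton_le hp hω hflow hx₀ hmax le_rfl)
  rw [hmin'] at hbd
  have hlt : slopeAt p ω ‖u 0‖ < √ω := by
    have h1 : 0 < 2 / p * ‖u 0‖ ^ (p - 2) :=
      mul_pos (div_pos two_pos (by linarith)) (Real.rpow_pos_of_pos hpos _)
    rw [slopeAt, Real.sqrt_lt_sqrt_iff_of_pos hω]
    linarith
  exact hlt.ne hbd

/-- The data of a truncated soliton of mass `μ` satisfying the boundary condition. -/
structure IsAdmissible (p α μ ω a : ℝ) : Prop where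
  sq_lt : α ^ 2 < ω
  slope_eq : solitonSlope p ω a = α
  mass_eq : ∫ x in Ioi 0, soliton p ω (x - a) ^ 2 = μ

lemma IsAdmissible.freq_pos {a : ℝ} (h : IsAdmissible p α μ ω a) : 0 < ω :=
  (sq_nonneg α).trans_lt h.sq_lt

lemma IsAdmissible.massIntegral_eq {a : ℝ} (h : IsAdmissible p α μ ω a) (hp : 2 < p) (hp4 : p ≤ 4)
    (hα : 0 < α) : coef p * (expo p * massIntegral α (expo p) ω) = μ := by
  have hm := (soliton_mass hp hp4 h.freq_pos a).2
  rw [h.mass_eq, h.slope_eq] at hm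
  rw [massIntegral, min_eq_of_sq_lt hα h.sq_lt, hm]

lemma exists_isAdmissible (hp : 2 < p) (hp4 : p ≤ 4) (hα : 0 < α)
    (hμ : ∫ x : ℝ, soliton p (α ^ 2) x ^ 2 < μ) : ∃ ω a, IsAdmissible p α μ ω a := by
  obtain ⟨ω, hω, hm⟩ := exists_freq_of_lt hp hp4 hα hμ
  have hω0 : 0 < ω := (sq_nonneg α).trans_lt hω
  obtain ⟨a, ha⟩ := exists_solitonSlope_eq hp hω0 hω
  exact ⟨ω, a, hω, ha, by rw [(soliton_mass hp hp4 hω0 a).2, ha, hm]⟩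

lemma IsAdmissible.unique {a ω' a' : ℝ} (h : IsAdmissible p α μ ω a)
    (h' : IsAdmissible p α μ ω' a') (hp : 2 < p) (hp4 : p ≤ 4) (hα : 0 < α) : ω' = ω ∧ a' = a := by
  have hω : ω' = ω := by
    by_contra hne
    have h1 := level_lt_level hp hp4 hα h'.freq_pos h.freq_pos (h.massIntegral_eq hp hp4 hα) hne
    have h2 := level_lt_level hp hp4 hα h.freq_pos h'.freq_pos (h'.massIntegral_eq hp hp4 hα)
      (Ne.symm hne)
    linarith
  subst hω
  exact ⟨rfl, (solitonSlope_strictMono hp h.freq_pos).injective (h'.slope_eq.trans h.slope_eq.symm)⟩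

lemma IsAdmissible.energy_eq (𝕜 : Type*) [RCLike 𝕜] {a : ℝ} (h : IsAdmissible p α μ ω a)
    (hp : 2 < p) (hp4 : p ≤ 4) (hα : 0 < α) :
    energy p α (fun x => (soliton p ω (x - a) : 𝕜)) = level p α μ ω := by
  rw [energy_soliton 𝕜 hp hp4 h.freq_pos, h.slope_eq, h.mass_eq, sub_self, level,
    action_eq (expo_pos hp) hα h.freq_pos, min_eq_of_sq_lt hα h.sq_lt]
  ring

lemma IsAdmissible.isGroundState (𝕜 : Type*) [RCLike 𝕜] {a : ℝ} (h : IsAdmissible p α μ ω a)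
    (hp : 2 < p) (hp4 : p ≤ 4) (hα : 0 < α) (hμ : 0 < μ) :
    IsGroundState p α μ (fun x => (soliton p ω (x - a) : 𝕜)) :=
  ⟨memH1_soliton 𝕜 hp hp4 h.freq_pos a, (mass_ofReal 𝕜 _).trans h.mass_eq, fun v hv hvm => by
    rw [h.energy_eq 𝕜 hp hp4 hα]
    exact (level_le_energy hp hp4 hα hμ h.freq_pos (h.massIntegral_eq hp hp4 hα) hv hvm).1⟩

lemma IsAdmissible.eq_of_isGroundState {𝕜 : Type*} [RCLike 𝕜] {a : ℝ}
    (h : IsAdmissible p α μ ω a) (hp : 2 < p) (hp4 : p ≤ 4) (hα : 0 < α) (hμ : 0 < μ) {v : ℝ → ℝ}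
    (hpos : IsPositive v) (hv : IsGroundState p α μ (fun x => (v x : 𝕜))) :
    ∀ x, 0 ≤ x → v x = soliton p ω (x - a) := by
  have hω := h.freq_pos
  obtain ⟨hH1, hm, hmin⟩ := hv
  have hg := h.isGroundState 𝕜 hp hp4 hα hμ
  have hle := hmin _ hg.1 hg.2.1
  rw [h.energy_eq 𝕜 hp hp4 hα] at hle
  obtain ⟨⟨x₀, hx₀, hmax⟩, hflow, hbd⟩ :=
    (level_le_energy hp hp4 hα hμ hω (h.massIntegral_eq hp hp4 hα) hH1 hm).2 hle
  rw [min_eq_of_sq_lt hα h.sq_lt, ← h.slope_eq] at hbd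
  have key := hH1.isProfile.eq_soliton hp hp4 hω hflow hx₀ hmax hbd
    (by rw [h.mass_eq]; exact hm)
  have hvc : ContinuousOn v (Ici 0) := by
    have := RCLike.continuous_re.comp_continuousOn hH1.1
    simpa [Function.comp_def] using this
  have hsc : Continuous fun x => soliton p ω (x - a) :=
    (continuous_soliton hp hω).comp (continuous_sub_right a)
  have hIoi : EqOn v (fun x => soliton p ω (x - a)) (Ioi 0) := fun x hx => by
    have := key x (le_of_lt hx)
    rwa [RCLike.norm_ofReal, abs_of_pos (hpos x hx)] at this
  have hIci : EqOn v (fun x => soliton p ω (x - a)) (Ici 0) :=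
    hIoi.of_subset_closure hvc hsc.continuousOn Ioi_subset_Ici_self (closure_Ioi (0 : ℝ)).ge
  exact fun x hx => hIci hx

lemma IsAdmissible.eq_of_isBoundState {a : ℝ} (h : IsAdmissible p α μ ω a) (hp : 2 < p)
    (hp4 : p ≤ 4) (hα : 0 < α) {v : ℝ → ℝ} (hpos : IsPositive v) (hv : IsBoundState p α μ v) :
    ∀ x, 0 ≤ x → v x = soliton p ω (x - a) := by
  obtain ⟨hm, ω', hω', hb⟩ := hv
  obtain ⟨a', ha', heq⟩ := hb.eq_soliton hp hω' hpos
  have h' : IsAdmissible p α μ ω' a' := by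
    refine ⟨ha' ▸ solitonSlope_sq_lt hω' a', ha', ?_⟩
    rw [← hm, mass]
    refine setIntegral_congr_fun measurableSet_Ioi fun x hx => ?_
    simp only [heq x (le_of_lt hx), Real.norm_eq_abs, sq_abs]
  obtain ⟨rfl, rfl⟩ := h.unique h' hp hp4 hα
  exact heq

end GroundState

end NLSHalfLine

theorem theorem1p2 {𝕜 : Type*} [RCLike 𝕜] (p α μ : ℝ) (hp : 2 < p) (hp4 : p ≤ 4)
    (hα : 0 < α) (hμ : 0 < μ) :
    ((∃ u : ℝ → 𝕜, NLSHalfLine.IsGroundState p α μ u) ↔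
        (∫ x : ℝ, (NLSHalfLine.soliton p (α ^ 2) x) ^ 2) < μ) ∧
      ((∃ u : ℝ → 𝕜, NLSHalfLine.IsGroundState p α μ u) →
        ∃ η : ℝ → ℝ,
          NLSHalfLine.IsPositive η ∧
          NLSHalfLine.IsGroundState p α μ (fun x => (η x : 𝕜)) ∧
          NLSHalfLine.IsBoundState p α μ η ∧
          (∃ ω a : ℝ, 0 < ω ∧ ∀ x, 0 ≤ x → η x = NLSHalfLine.soliton p ω (x - a)) ∧
          (∀ v : ℝ → ℝ, NLSHalfLine.IsPositive v →
            NLSHalfLine.IsGroundState p α μ (fun x => (v x : 𝕜)) → ∀ x, 0 ≤ x → v x = η x) ∧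
          (∀ v : ℝ → ℝ, NLSHalfLine.IsPositive v →
            NLSHalfLine.IsBoundState p α μ v → ∀ x, 0 ≤ x → v x = η x)) := by
  have hiff : (∃ u : ℝ → 𝕜, NLSHalfLine.IsGroundState p α μ u) ↔
      (∫ x : ℝ, (NLSHalfLine.soliton p (α ^ 2) x) ^ 2) < μ := by
    constructor
    · rintro ⟨u, hu⟩
      by_contra! hle
      exact NLSHalfLine.not_isGroundState hp hp4 hα hμ hle u hu
    · intro hlt
      obtain ⟨ω, a, h⟩ := NLSHalfLine.exists_isAdmissible hp hp4 hα hlt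
      exact ⟨_, h.isGroundState 𝕜 hp hp4 hα hμ⟩
  refine ⟨hiff, fun hex => ?_⟩
  obtain ⟨ω, a, h⟩ := NLSHalfLine.exists_isAdmissible hp hp4 hα (hiff.1 hex)
  have hω := h.freq_pos
  refine ⟨fun x => NLSHalfLine.soliton p ω (x - a), fun x _ => NLSHalfLine.soliton_pos hp hω _,
    h.isGroundState 𝕜 hp hp4 hα hμ, ⟨?_, ω, hω, NLSHalfLine.isBoundStateAt_soliton hp hp4 hω
      h.slope_eq⟩, ⟨ω, a, hω, fun _ _ => rfl⟩, fun v hv hg => ?_, fun v hv hb => ?_⟩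
  · simpa using (NLSHalfLine.mass_ofReal ℝ _).trans h.mass_eq
  · exact h.eq_of_isGroundState hp hp4 hα hμ hv hg
  · exact h.eq_of_isBoundState hp hp4 hα hv hb
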